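/- Let $E$ and $F$ be real vector lattices with $F$ Dedekind complete, let $\mathcal L_{\mathrm{ob}}(E,F)$ be the vector lattice of order bounded operators $E\to F$, and let $\tau_F$ be an o-Lebesgue topology on $F$. Let $\mathcal E$ be a regular vector sublattice of $\mathcal L_{\mathrm{ob}}(E,F)$ (a vector sublattice whose inclusion map is order continuous). Here a locally solid linear topology on a vector lattice is a (not necessarily Hausdorff) vector space topology with a base of solid neighbourhoods of $0$; it is called *o-Lebesgue* (resp. *uo-Lebesgue*) if every net that is order convergent (resp. unbounded order convergent) to $0$ converges to $0$ in it. For a non-empty $S\subseteq E$, $\mathrm{Abs}_S\tau_F$ denotes the absolute strong operator topology, i.e. the translation invariant topology on $\mathcal E$ (or on $\mathcal L_{\mathrm{ob}}(E,F)$) for which $T_\alpha\to 0$ if and only if $|T_\alpha||s|\to 0$ in $\tau_F$ for all $s\in S$. For a locally solid linear topology $\tau$ on a vector lattice $V$ and a non-empty $\mathcal S\subseteq V$, the unbounded topology $\mathrm u_{\mathcal S}\tau$ is the translation invariant topology on $V$ for which $x_\alpha\to0$ if and only if $|x_\alpha|\wedge|s|\to0$ in $\tau$ for all $s\in\mathcal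 S$. The ideal generated by a set $S$ is denoted by $I_S$. **(A)** Let $\mathcal S\subseteq\mathcal E$ and $S\subseteq E$ be non-empty. Then $\mathrm u_{\mathcal S}\mathrm{Abs}_S\tau_F$ is a uo-Lebesgue topology on $\mathcal E$, and for a net $(T_\alpha)$ in $\mathcal E$ the following are equivalent: 1. $T_\alpha\to0$ in $\mathrm u_{\mathcal S}\mathrm{Abs}_S\tau_F$; 2. $(|T_\alpha|\wedge|T|)|s|\to0$ in $\tau_F$ for all $T\in\mathcal S$ and $s\in S$; 3. $(|T_\alpha|\wedge|T|)x\to0$ in $\tau_F$ for all $T\in I_{\mathcal S}$ (the ideal generated in $\mathcal E$) and $x\in I_S$. If, in addition, $\tau_F$ is Hausdorff, then $\mathrm u_{\mathcal S}\mathrm{Abs}_S\tau_F$ is a Hausdorff uo-Lebesgue topology on $\mathcal E$ if and only if $I_S$ separates the points of $\mathcal E$ and $I_{\mathcal S}$ is order dense in $\mathcal E$. In that case it is the only Hausdorff uo-Lebesgue topology on $\mathcal E$, it is the restriction to $\mathcal E$ of $\mathrm u_{\mathcal L_{\mathrm{ob}}(E,F)}\mathrm{Abs}_E\tau_F$, and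 1--3 are also equivalent to 4. $(|T_\alpha|\wedge|T|)x\to0$ in $\tau_F$ for all $T\in\mathcal L_{\mathrm{ob}}(E,F)$ and $x\in E$. **(B)** Suppose that $\tau_F$ is Hausdorff. Then $\mathrm u_{\mathcal L_{\mathrm{ob}}(E,F)}\mathrm{Abs}_E\tau_F$ is the unique Hausdorff uo-Lebesgue topology on $\mathcal L_{\mathrm{ob}}(E,F)$. Moreover, $\mathcal E$ admits a unique Hausdorff uo-Lebesgue topology $\widehat\tau_{\mathcal E}$. It equals $\mathrm u_{\mathcal E}\mathrm{Abs}_E\tau_F$, and it is also the restriction to $\mathcal E$ of $\mathrm u_{\mathcal L_{\mathrm{ob}}(E,F)}\mathrm{Abs}_E\tau_F$. For a net $(T_\alpha)$ in $\mathcal E$ the following are equivalent: 1. $T_\alpha\to0$ in $\widehat\tau_{\mathcal E}$; 2. $(|T_\alpha|\wedge|T|)x\to0$ in $\tau_F$ for all $T\in\mathcal E$ and $x\in E$; 3. $(|T_\alpha|\wedge|T|)x\to0$ in $\tau_F$ for all $T\in\mathcal L_{\mathrm{ob}}(E,F)$ and $x\in E$. -/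

import Mathlib

open Filter Topology

universe u v w

/-! ### Real vector lattices: convergence and topologies -/

section Convergence

variable {V : Type u} [AddCommGroup V] [Lattice V]

/-- The net `x` in the vector lattice `V` is order convergent to `l`: there is a net `y`, with a
possibly different index set, such that `y ↓ 0` and every `y b` eventually dominates `|l - x a|`. -/
def OrderConverges {A : Type w} [Preorder A] (x : A → V) (l : V) : Prop :=
  ∃ (B : Type u) (_ : PartialOrder B) (_ : IsDirectedOrder B) (_ : Nonempty B) (y : B → V),
    Antitone y ∧ IsGLB (Set.range y) 0 ∧ ∀ b₀ : B, ∃ a₀ : A, ∀ a : A, a₀ ≤ a → |l - x a| ≤ y b₀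

/-- Unbounded order convergence of the net `x` to `l`. -/
def UnboundedOrderConverges {A : Type w} [Preorder A] (x : A → V) (l : V) : Prop :=
  ∀ y : V, 0 ≤ y → OrderConverges (fun a => |x a - l| ⊓ y) 0

variable [Module ℝ V]

/-- A (not necessarily Hausdorff) locally solid linear topology on a vector lattice. -/
structure IsLocallySolidLinear (τ : TopologicalSpace V) : Prop where
  add : @IsTopologicalAddGroup V τ _
  smul : @ContinuousSMul ℝ V _ _ τ
  solid : ∀ U ∈ @nhds V τ 0, ∃ W ∈ @nhds V τ 0, LatticeOrderedAddCommGroup.IsSolid W ∧ W ⊆ U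

/-- A (not necessarily Hausdorff) o-Lebesgue topology: a locally solid linear topology in which
every net that is order convergent to `0` converges to `0`. -/
structure IsOLebesgue (τ : TopologicalSpace V) : Prop where
  locallySolid : IsLocallySolidLinear τ
  tendsto : ∀ (A : Type u) [Preorder A] [IsDirectedOrder A] [Nonempty A] (x : A → V),
    OrderConverges x 0 → Tendsto x atTop (@nhds V τ 0)

/-- A (not necessarily Hausdorff) uo-Lebesgue topology: a locally solid linear topology in which
every net that is unbounded order convergent to `0` converges to `0`. -/
structure IsUOLebesgue (τ : TopologicalSpace V) : Prop where
  locallySolid : IsLocallySolidLinear τ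
  tendsto : ∀ (A : Type u) [Preorder A] [IsDirectedOrder A] [Nonempty A] (x : A → V),
    UnboundedOrderConverges x 0 → Tendsto x atTop (@nhds V τ 0)

/-- A Hausdorff uo-Lebesgue topology. -/
def IsHausdorffUOLebesgue (τ : TopologicalSpace V) : Prop :=
  IsUOLebesgue τ ∧ @T2Space V τ

/-- The (order) ideal generated by `S`: the least solid linear subspace containing `S`. -/
def idealSpan (S : Set V) : Submodule ℝ V :=
  sInf {J : Submodule ℝ V | LatticeOrderedAddCommGroup.IsSolid (J : Set V) ∧ S ⊆ J}

/-- The linear subspace `G` is order dense in `V`. -/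
def IsOrderDense (G : Submodule ℝ V) : Prop :=
  ∀ v : V, 0 < v → ∃ g ∈ G, 0 < g ∧ g ≤ v

end Convergence

/-! ### Vector sublattices -/

/-- A vector sublattice: a linear subspace closed under the lattice operations. -/
structure VectorSublattice (V : Type u) [AddCommGroup V] [Lattice V] [Module ℝ V] extends
    Submodule ℝ V where
  sup_mem' : ∀ {x y : V}, x ∈ carrier → y ∈ carrier → x ⊔ y ∈ carrier
  inf_mem' : ∀ {x y : V}, x ∈ carrier → y ∈ carrier → x ⊓ y ∈ carrier

namespace VectorSublattice

variable {V : Type u} [AddCommGroup V] [Lattice V] [Module ℝ V]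

instance : SetLike (VectorSublattice V) V where
  coe G := G.carrier
  coe_injective G H h := by
    obtain ⟨G, _, _⟩ := G
    obtain ⟨H, _, _⟩ := H
    have : G = H := SetLike.coe_injective h
    subst this
    rfl

instance : AddSubgroupClass (VectorSublattice V) V where
  add_mem {G} := G.toSubmodule.add_mem
  zero_mem G := G.toSubmodule.zero_mem
  neg_mem {G} := G.toSubmodule.neg_mem

instance : SMulMemClass (VectorSublattice V) ℝ V where
  smul_mem {G} r {_} h := G.toSubmodule.smul_mem r h

/-- A vector sublattice is a vector lattice for the inherited order. -/
instance (G : VectorSublattice V) : Lattice G :=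
  Subtype.lattice (fun _ _ hx hy => G.sup_mem' hx hy) (fun _ _ hx hy => G.inf_mem' hx hy)

/-- `G` is a regular vector sublattice: its inclusion map is order continuous. -/
def IsRegular (G : VectorSublattice V) : Prop :=
  ∀ (A : Type u) [Preorder A] [IsDirectedOrder A] [Nonempty A] (x : A → G),
    OrderConverges x 0 → OrderConverges (fun a => (x a : V)) 0

end VectorSublattice

/-! ### The vector lattice of order bounded operators -/

section Operators

variable (E : Type u) (F : Type v) [AddCommGroup E] [Lattice E] [Module ℝ E]
  [AddCommGroup F] [Lattice F] [IsOrderedAddMonoid F] [Module ℝ F] [IsOrderedModule ℝ F]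

/-- The linear maps that map order intervals to order bounded sets. -/
def orderBoundedSubmodule : Submodule ℝ (E →ₗ[ℝ] F) where
  carrier := {T | ∀ a b : E, BddAbove (T '' Set.Icc a b) ∧ BddBelow (T '' Set.Icc a b)}
  zero_mem' a b := by
    refine ⟨⟨0, ?_⟩, ⟨0, ?_⟩⟩ <;> rintro _ ⟨x, -, rfl⟩ <;> simp
  add_mem' {S T} hS hT a b := by
    obtain ⟨⟨s, hs⟩, ⟨s', hs'⟩⟩ := hS a b
    obtain ⟨⟨t, ht⟩, ⟨t', ht'⟩⟩ := hT a b
    refine ⟨⟨s + t, ?_⟩, ⟨s' + t', ?_⟩⟩ <;> rintro _ ⟨x, hx, rfl⟩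
    · exact add_le_add (hs ⟨x, hx, rfl⟩) (ht ⟨x, hx, rfl⟩)
    · exact add_le_add (hs' ⟨x, hx, rfl⟩) (ht' ⟨x, hx, rfl⟩)
  smul_mem' c T hT a b := by
    obtain ⟨⟨t, ht⟩, ⟨t', ht'⟩⟩ := hT a b
    rcases le_total 0 c with hc | hc
    · refine ⟨⟨c • t, ?_⟩, ⟨c • t', ?_⟩⟩ <;> rintro _ ⟨x, hx, rfl⟩
      · exact smul_le_smul_of_nonneg_left (ht ⟨x, hx, rfl⟩) hc
      · exact smul_le_smul_of_nonneg_left (ht' ⟨x, hx, rfl⟩) hc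
    · refine ⟨⟨c • t', ?_⟩, ⟨c • t, ?_⟩⟩ <;> rintro _ ⟨x, hx, rfl⟩
      · exact smul_le_smul_of_nonpos_left (ht' ⟨x, hx, rfl⟩) hc
      · exact smul_le_smul_of_nonpos_left (ht ⟨x, hx, rfl⟩) hc

/-- The space of order bounded operators from `E` to `F`. -/
def OrderBoundedOperator : Type (max u v) := orderBoundedSubmodule E F

namespace OrderBoundedOperator

instance : AddCommGroup (OrderBoundedOperator E F) :=
  inferInstanceAs (AddCommGroup (orderBoundedSubmodule E F))

instance : Module ℝ (OrderBoundedOperator E F) :=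
  inferInstanceAs (Module ℝ (orderBoundedSubmodule E F))

variable {E F}

instance : FunLike (OrderBoundedOperator E F) E F where
  coe T := T.1
  coe_injective _ _ h := Subtype.ext (DFunLike.coe_injective h)

instance : LinearMapClass (OrderBoundedOperator E F) ℝ E F where
  map_add T := T.1.map_add
  map_smulₛₗ T := T.1.map_smul

@[ext] theorem ext {S T : OrderBoundedOperator E F} (h : ∀ x, S x = T x) : S = T :=
  DFunLike.ext _ _ h

@[simp] theorem add_apply (S T : OrderBoundedOperator E F) (x : E) : (S + T) x = S x + T x := rfl
@[simp] theorem sub_apply (S T : OrderBoundedOperator E F) (x : E) : (S - T) x = S x - T x := rfl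
@[simp] theorem neg_apply (T : OrderBoundedOperator E F) (x : E) : (-T) x = -T x := rfl
@[simp] theorem zero_apply (x : E) : (0 : OrderBoundedOperator E F) x = 0 := rfl
@[simp] theorem smul_apply (c : ℝ) (T : OrderBoundedOperator E F) (x : E) :
    (c • T) x = c • T x := rfl

variable [IsOrderedAddMonoid E] [IsOrderedModule ℝ E]

/-- The operator order: `S ≤ T` if and only if `S x ≤ T x` for all `x ≥ 0`. -/
instance : PartialOrder (OrderBoundedOperator E F) where
  le S T := ∀ x : E, 0 ≤ x → S x ≤ T x
  le_refl _ _ _ := le_rfl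
  le_trans _ _ _ h₁ h₂ x hx := (h₁ x hx).trans (h₂ x hx)
  le_antisymm S T h₁ h₂ := by
    ext x
    have h : ∀ y : E, 0 ≤ y → S y = T y := fun y hy => (h₁ y hy).antisymm (h₂ y hy)
    rw [← posPart_sub_negPart x, map_sub, map_sub, h _ (posPart_nonneg x), h _ (negPart_nonneg x)]

theorem le_def {S T : OrderBoundedOperator E F} : S ≤ T ↔ ∀ x : E, 0 ≤ x → S x ≤ T x := Iff.rfl

instance : IsOrderedAddMonoid (OrderBoundedOperator E F) where
  add_le_add_left _ _ h R x hx := add_le_add_left (h x hx) (R x)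

instance : IsOrderedModule ℝ (OrderBoundedOperator E F) where
  smul_le_smul_of_nonneg_left _ hc _ _ h x hx := smul_le_smul_of_nonneg_left (h x hx) hc
  smul_le_smul_of_nonneg_right _ hT _ _ h x hx := smul_le_smul_of_nonneg_right h (hT x hx)

end OrderBoundedOperator

end Operators

/-! For a Dedekind complete codomain the order bounded operators form a lattice; the positive part
of `T` is given on the positive cone by the Riesz-Kantorovich formula. -/

namespace OrderBoundedOperator

variable {E : Type u} {F : Type v}
  [AddCommGroup E] [Lattice E] [IsOrderedAddMonoid E] [Module ℝ E] [IsOrderedModule ℝ E]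
  [AddCommGroup F] [ConditionallyCompleteLattice F] [IsOrderedAddMonoid F] [Module ℝ F]
  [IsOrderedModule ℝ F]

/-- The Riesz-Kantorovich formula for the positive part of `T` at `x ≥ 0`. -/
noncomputable def rk (T : OrderBoundedOperator E F) (x : E) : F := sSup (T '' Set.Icc 0 x)

theorem le_rk (T : OrderBoundedOperator E F) {x z : E} (h0 : 0 ≤ z) (h : z ≤ x) :
    T z ≤ rk T x :=
  le_csSup (T.2 0 x).1 ⟨z, ⟨h0, h⟩, rfl⟩

theorem rk_le (T : OrderBoundedOperator E F) {x : E} {f : F} (hx : 0 ≤ x)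
    (h : ∀ z, 0 ≤ z → z ≤ x → T z ≤ f) : rk T x ≤ f :=
  csSup_le ⟨_, 0, ⟨le_rfl, hx⟩, rfl⟩ (by rintro _ ⟨z, ⟨h0, hz⟩, rfl⟩; exact h z h0 hz)

theorem rk_add (T : OrderBoundedOperator E F) {x y : E} (hx : 0 ≤ x) (hy : 0 ≤ y) :
    rk T (x + y) = rk T x + rk T y := by
  apply le_antisymm
  · refine rk_le T (add_nonneg hx hy) fun z h0 hz => ?_
    have h1 : z = z ⊓ x + (z - z ⊓ x) := by abel
    rw [h1, map_add]
    refine add_le_add (le_rk T (le_inf h0 hx) inf_le_right)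
      (le_rk T (sub_nonneg.2 inf_le_left) ?_)
    rw [sub_le_iff_le_add', ← sub_le_iff_le_add]
    exact le_inf (sub_le_self _ hy) (sub_le_iff_le_add.2 hz)
  · rw [← le_sub_iff_add_le]
    refine rk_le T hx fun a ha hax => ?_
    rw [le_sub_comm]
    refine rk_le T hy fun b hb hby => ?_
    rw [le_sub_iff_add_le, ← map_add]
    exact le_rk T (add_nonneg hb ha) (by rw [add_comm]; exact add_le_add hax hby)

theorem rk_zero (T : OrderBoundedOperator E F) : rk T 0 = 0 := by
  simp [rk]

theorem rk_nonneg (T : OrderBoundedOperator E F) {x : E} (hx : 0 ≤ x) : 0 ≤ rk T x := by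
  simpa using le_rk T le_rfl hx

theorem rk_smul_le (T : OrderBoundedOperator E F) {c : ℝ} (hc : 0 < c) {x : E} (hx : 0 ≤ x) :
    rk T (c • x) ≤ c • rk T x := by
  refine rk_le T (smul_nonneg hc.le hx) fun z h0 hz => ?_
  have h1 : z = c • c⁻¹ • z := by rw [smul_inv_smul₀ hc.ne']
  rw [h1, map_smul]
  refine smul_le_smul_of_nonneg_left (le_rk T (smul_nonneg (inv_nonneg.2 hc.le) h0) ?_) hc.le
  have := smul_le_smul_of_nonneg_left hz (inv_nonneg.2 hc.le)
  rwa [inv_smul_smul₀ hc.ne'] at this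

theorem rk_smul (T : OrderBoundedOperator E F) {c : ℝ} (hc : 0 ≤ c) {x : E} (hx : 0 ≤ x) :
    rk T (c • x) = c • rk T x := by
  rcases hc.eq_or_lt with rfl | hc
  · simp [rk_zero]
  · refine (rk_smul_le T hc hx).antisymm ?_
    have h := rk_smul_le T (inv_pos.2 hc) (smul_nonneg hc.le hx)
    rw [inv_smul_smul₀ hc.ne'] at h
    have := smul_le_smul_of_nonneg_left h hc.le
    rwa [smul_inv_smul₀ hc.ne'] at this

theorem rk_sub (T : OrderBoundedOperator E F) {a b : E} (ha : 0 ≤ a) (hb : 0 ≤ b) :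
    rk T (a - b)⁺ - rk T (a - b)⁻ = rk T a - rk T b := by
  rw [sub_eq_sub_iff_add_eq_add, ← rk_add T (posPart_nonneg _) hb,
    ← rk_add T ha (negPart_nonneg _)]
  congr 1
  rw [← sub_eq_sub_iff_add_eq_add, posPart_sub_negPart]

/-- The linear extension of the Riesz-Kantorovich formula. -/
noncomputable def pos (T : OrderBoundedOperator E F) : E →ₗ[ℝ] F where
  toFun x := rk T x⁺ - rk T x⁻
  map_add' x y := by
    have h : x + y = (x⁺ + y⁺) - (x⁻ + y⁻) := by
      rw [add_sub_add_comm, posPart_sub_negPart, posPart_sub_negPart]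
    rw [h, rk_sub T (add_nonneg (posPart_nonneg x) (posPart_nonneg y))
      (add_nonneg (negPart_nonneg x) (negPart_nonneg y)),
      rk_add T (posPart_nonneg x) (posPart_nonneg y),
      rk_add T (negPart_nonneg x) (negPart_nonneg y), add_sub_add_comm]
  map_smul' c x := by
    have h : c • x = c • x⁺ - c • x⁻ := by rw [← smul_sub, posPart_sub_negPart]
    rcases le_total 0 c with hc | hc
    · rw [h, rk_sub T (smul_nonneg hc (posPart_nonneg x)) (smul_nonneg hc (negPart_nonneg x)),
        rk_smul T hc (posPart_nonneg x), rk_smul T hc (negPart_nonneg x), ← smul_sub]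
      rfl
    · have hc' : 0 ≤ -c := neg_nonneg.2 hc
      have h' : c • x = (-c) • x⁻ - (-c) • x⁺ := by rw [h, neg_smul, neg_smul]; abel
      rw [h', rk_sub T (smul_nonneg hc' (negPart_nonneg x)) (smul_nonneg hc' (posPart_nonneg x)),
        rk_smul T hc' (posPart_nonneg x), rk_smul T hc' (negPart_nonneg x), neg_smul, neg_smul,
        RingHom.id_apply, smul_sub]
      abel

theorem pos_apply (T : OrderBoundedOperator E F) {x : E} (hx : 0 ≤ x) : pos T x = rk T x := by
  change rk T x⁺ - rk T x⁻ = rk T x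
  rw [posPart_eq_self.2 hx, negPart_eq_zero.2 hx, rk_zero, sub_zero]

theorem pos_mono (T : OrderBoundedOperator E F) : Monotone (pos T) := by
  intro x y h
  rw [← sub_nonneg, ← map_sub, pos_apply T (sub_nonneg.2 h)]
  exact rk_nonneg T (sub_nonneg.2 h)

/-- The positive part of an order bounded operator. -/
noncomputable def posOp (T : OrderBoundedOperator E F) : OrderBoundedOperator E F :=
  ⟨pos T, fun a b => ⟨⟨pos T b, by rintro _ ⟨x, hx, rfl⟩; exact pos_mono T hx.2⟩,
    ⟨pos T a, by rintro _ ⟨x, hx, rfl⟩; exact pos_mono T hx.1⟩⟩⟩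

theorem posOp_apply (T : OrderBoundedOperator E F) {x : E} (hx : 0 ≤ x) : posOp T x = rk T x :=
  pos_apply T hx

theorem le_posOp (T : OrderBoundedOperator E F) : T ≤ posOp T := fun x hx => by
  rw [posOp_apply T hx]; exact le_rk T hx le_rfl

theorem posOp_nonneg (T : OrderBoundedOperator E F) : 0 ≤ posOp T := fun x hx => by
  rw [posOp_apply T hx]; exact rk_nonneg T hx

theorem posOp_le {T R : OrderBoundedOperator E F} (h : T ≤ R) (h0 : 0 ≤ R) : posOp T ≤ R :=
  fun x hx => by
    rw [posOp_apply T hx]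
    refine rk_le T hx fun z hz hzx => (h z hz).trans ?_
    have := h0 (x - z) (sub_nonneg.2 hzx)
    rwa [zero_apply, map_sub, sub_nonneg] at this

/-- The lattice structure of the order bounded operators, for the operator order. -/
noncomputable instance : Lattice (OrderBoundedOperator E F) where
  sup S T := S + posOp (T - S)
  inf S T := S - posOp (S - T)
  le_sup_left S T := le_add_of_nonneg_right (posOp_nonneg _)
  le_sup_right S T := by
    rw [← sub_le_iff_le_add']; exact le_posOp _
  sup_le S T R h₁ h₂ := by
    rw [← le_sub_iff_add_le']
    exact posOp_le (sub_le_sub_right h₂ S) (sub_nonneg.2 h₁)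
  inf_le_left S T := sub_le_self _ (posOp_nonneg _)
  inf_le_right S T := by
    rw [sub_le_comm]; exact le_posOp _
  le_inf R S T h₁ h₂ := by
    rw [le_sub_comm]
    exact posOp_le (sub_le_sub_left h₂ S) (sub_nonneg.2 h₁)

end OrderBoundedOperator

/-! ### Unbounded topologies and absolute strong operator topologies -/

/-- The topology on `V` in which the neighbourhoods of `a` are generated by the sets
`{b | p i (b - a) ∈ U}` with `i : ι` and `U` a `τ`-neighbourhood of `0`. -/
def gaugeTopology {ι V W : Type*} [AddCommGroup V] [AddCommGroup W] (p : ι → V → W)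
    (τ : TopologicalSpace W) : TopologicalSpace V :=
  TopologicalSpace.mkOfNhds fun a => ⨅ i, comap (fun b => p i (b - a)) (@nhds W τ 0)

/-- For a locally solid topology `τ` and a family of subadditive maps `p` with values in the
positive cone, the prescribed neighbourhoods are the actual ones. -/
theorem nhds_gaugeTopology {ι V W : Type*} [AddCommGroup V] [AddCommGroup W] [Lattice W]
    [IsOrderedAddMonoid W] [Module ℝ W] {p : ι → V → W} {τ : TopologicalSpace W}
    (hτ : IsLocallySolidLinear τ) (h0 : ∀ i, p i 0 = 0) (hp : ∀ i b, 0 ≤ p i b)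
    (hadd : ∀ i b c, p i (b + c) ≤ p i b + p i c) (a : V) :
    @nhds V (gaugeTopology p τ) a = ⨅ i, comap (fun b => p i (b - a)) (@nhds W τ 0) := by
  let _ := τ
  have := hτ.add
  refine TopologicalSpace.nhds_mkOfNhds _ _ (fun a => ?_) fun a s hs => ?_
  · refine le_iInf fun i => ?_
    rw [← map_le_iff_le_comap, map_pure, sub_self, h0]
    exact pure_le_nhds 0
  · refine iInf_sets_induct (p := fun s => ∀ᶠ y in ⨅ i, comap (fun b => p i (b - a)) (𝓝 (0 : W)),
      s ∈ ⨅ i, comap (fun b => p i (b - y)) (𝓝 (0 : W))) hs (by simp) ?_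
    · intro i s₁ s₂ h₁ ih
      obtain ⟨U, hU, hUs⟩ := mem_comap.1 h₁
      obtain ⟨U', hU', hsol, hUU⟩ := hτ.solid U hU
      obtain ⟨W₁, hW₁, hWW⟩ := exists_nhds_zero_half hU'
      have hW : ∀ᶠ y in ⨅ i, comap (fun b => p i (b - a)) (𝓝 (0 : W)), p i (y - a) ∈ W₁ :=
        mem_iInf_of_mem i (preimage_mem_comap hW₁)
      filter_upwards [hW, ih] with y hy hy₂
      refine inter_mem (mem_iInf_of_mem i (mem_of_superset (preimage_mem_comap hW₁) ?_)) hy₂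
      intro z hz
      refine hUs (hUU (hsol (hWW _ hz _ hy) ?_))
      rw [abs_of_nonneg (hp i _), abs_of_nonneg (add_nonneg (hp i _) (hp i _))]
      simpa using hadd i (z - y) (y - a)

/-- The unbounded topology on `V` generated by the locally solid linear topology `τ` on `V` via
`S`. -/
def unboundedTopology {V : Type u} [AddCommGroup V] [Lattice V] (S : Set V)
    (τ : TopologicalSpace V) : TopologicalSpace V :=
  gaugeTopology (fun (s : S) (x : V) => |x| ⊓ |(s : V)|) τ

/-- The defining property of the unbounded topology: `x → 0` if and only if
`|x| ⊓ |s| → 0` for all `s ∈ S`. -/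
theorem tendsto_unboundedTopology {V : Type u} [AddCommGroup V] [Lattice V]
    [IsOrderedAddMonoid V] [Module ℝ V] (S : Set V) {τ : TopologicalSpace V}
    (hτ : IsLocallySolidLinear τ) {A : Type w} (l : Filter A) (x : A → V) :
    Tendsto x l (@nhds V (unboundedTopology S τ) 0) ↔
      ∀ s ∈ S, Tendsto (fun a => |x a| ⊓ |s|) l (@nhds V τ 0) := by
  rw [unboundedTopology, nhds_gaugeTopology hτ]
  · simp [tendsto_iInf, tendsto_comap_iff, Function.comp_def]
  · intro s
    rw [abs_zero]
    exact inf_of_le_left (abs_nonneg _)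
  · exact fun s b => le_inf (abs_nonneg _) (abs_nonneg _)
  · intro s b c
    rw [← sub_le_iff_le_add]
    refine le_inf ?_ ?_
    · rw [sub_le_comm]
      refine le_inf ?_ ?_
      · rw [sub_le_iff_le_add']
        exact inf_le_left.trans (abs_add_le b c)
      · exact (sub_le_self _ (abs_nonneg b)).trans inf_le_right
    · exact (sub_le_self _ (le_inf (abs_nonneg _) (abs_nonneg _))).trans inf_le_right

section AbsoluteStrong

variable {E : Type u} {F : Type v}
  [AddCommGroup E] [Lattice E] [IsOrderedAddMonoid E] [Module ℝ E] [IsOrderedModule ℝ E]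
  [AddCommGroup F] [ConditionallyCompleteLattice F] [IsOrderedAddMonoid F] [Module ℝ F]
  [IsOrderedModule ℝ F]

/-- The absolute strong operator topology on the order bounded operators generated by the locally
solid linear topology `τF` on `F` via `S`. On a vector sublattice one takes its restriction. -/
noncomputable def absoluteStrongTopology (S : Set E) (τF : TopologicalSpace F) :
    TopologicalSpace (OrderBoundedOperator E F) :=
  gaugeTopology (fun (s : S) (T : OrderBoundedOperator E F) => |T| |(s : E)|) τF

/-- The defining property of the absolute strong operator topology: `T → 0` if and only if
`|T| |s| → 0` for all `s ∈ S`. -/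
theorem tendsto_absoluteStrongTopology (S : Set E) {τF : TopologicalSpace F}
    (hτ : IsLocallySolidLinear τF) {A : Type w} (l : Filter A) (T : A → OrderBoundedOperator E F) :
    Tendsto T l (@nhds _ (absoluteStrongTopology S τF) 0) ↔
      ∀ s ∈ S, Tendsto (fun a => |T a| |s|) l (@nhds F τF 0) := by
  rw [absoluteStrongTopology, nhds_gaugeTopology hτ]
  · simp [tendsto_iInf, tendsto_comap_iff, Function.comp_def]
  · intro s
    simp
  · exact fun s T => abs_nonneg T _ (abs_nonneg (s : E))
  · exact fun s T R => abs_add_le T R _ (abs_nonneg (s : E))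

/-- The set `X` of vectors separates the points of the set `G` of operators. -/
def SeparatesOperators (X : Set E) (G : Set (OrderBoundedOperator E F)) : Prop :=
  ∀ T₁ ∈ G, ∀ T₂ ∈ G, T₁ ≠ T₂ → ∃ x ∈ X, T₁ x ≠ T₂ x

namespace VectorSublattice

variable (G : VectorSublattice (OrderBoundedOperator E F))

/-- The restriction to the vector sublattice `G` of the absolute strong operator topology generated
by `τF` via `S`. -/
noncomputable def absoluteStrongTopology (S : Set E) (τF : TopologicalSpace F) : TopologicalSpace G :=
  (_root_.absoluteStrongTopology S τF).induced (fun T : G => (T : OrderBoundedOperator E F))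

end VectorSublattice

end AbsoluteStrong

/-!
# Hausdorff uo-Lebesgue topologies on vector lattices of order bounded operators

The statement has a part valid in every vector lattice, the uniqueness of a Hausdorff uo-Lebesgue
topology (`IsHausdorffUOLebesgue.unique`), and a part about operators, the description of that
topology by the action of the operators.

*Uniqueness.* No Dedekind completion is used. An upward directed bounded set `A` need not have a
supremum, but in an Archimedean vector lattice the differences between its upper bounds and its
elements have infimum `0`, so that in a Lebesgue topology upper bounds of `A` come arbitrarily close
to elements of `A`. Given a normal sequence `W n` of solid neighbourhoods of `0`, its kernel `⋂ W n`
is a band, and a bounded sequence that is disjoint from the kernel and whose tails have small finite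
suprema is order null (`IsNormalSequence.isGLB_tail`). This is used twice.

* If `τ` is Hausdorff, the elements disjoint from the kernel of some `τ`-normal sequence are order
  dense, hence approximate any `u ≥ 0` in a second Lebesgue topology `σ`; a sequence `x n ∈ W n` in
  `[0, u]`, cut down to such an element, is then order null and thus `σ`-null. So `τ` is finer than
  `σ` on order intervals (`IsMonotoneLebesgue.exists_nhds_inter_Icc_subset`).
* If `τ` is uo-Lebesgue but `x ⊓ u` could be small for large `u` without `x` being small, there would
  be a sequence of elements outside a fixed neighbourhood, each almost disjoint from the sum of its
  predecessors; such a sequence is unbounded order null, like a disjoint sequence. So `τ` is an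
  unbounded topology (`IsUOLebesgue.exists_nhds_of_inf_mem`).

Together these show that each of two Hausdorff uo-Lebesgue topologies is finer than the other.

*Operators.* A downward directed set of positive operators has a pointwise infimum on the positive
cone, so order convergence of operators implies convergence of their moduli at every positive vector;
with the regularity of the sublattice this gives the uo-Lebesgue property. The test sets may be
replaced by the ideals that they generate because the admissible test elements form an ideal, and the
Hausdorff property is tested on constant nets, for which convergence is equality. That test operators
outside the sublattice `G` add nothing (`tendsto_inf_apply_of_sublattice`) holds because a positive
operator `R` is the sum of `R ⊓ g` with `g ∈ G`, of an operator disjoint from `G`, and of a remainder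
that is small at a given vector. All remaining identifications of topologies follow from uniqueness.
-/

/-! ### Elementary inequalities in vector lattices -/

section Inequalities

variable {V : Type u} [AddCommGroup V] [Lattice V] [IsOrderedAddMonoid V]

theorem add_inf_le_inf_add_inf {a b c : V} (ha : 0 ≤ a) (hb : 0 ≤ b) (hc : 0 ≤ c) :
    (a + b) ⊓ c ≤ a ⊓ c + b ⊓ c := by
  rw [← sub_le_iff_le_add]
  refine le_inf ?_ ?_
  · rw [sub_le_comm]
    refine le_inf ?_ ?_
    · rw [sub_le_iff_le_add']
      exact inf_le_left
    · exact (sub_le_self _ ha).trans inf_le_right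
  · exact (sub_le_self _ (le_inf hb hc)).trans inf_le_right

theorem inf_add_le_inf_add_inf {a b c : V} (ha : 0 ≤ a) (hb : 0 ≤ b) (hc : 0 ≤ c) :
    c ⊓ (a + b) ≤ c ⊓ a + c ⊓ b := by
  simpa only [inf_comm c] using add_inf_le_inf_add_inf ha hb hc

theorem sum_inf_le_sum_inf {ι : Type*} (s : Finset ι) {x : ι → V} {c : V} (hx : ∀ i, 0 ≤ x i)
    (hc : 0 ≤ c) : (∑ i ∈ s, x i) ⊓ c ≤ ∑ i ∈ s, x i ⊓ c := by
  classical
  induction s using Finset.induction_on with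
  | empty => simp
  | insert i s hi ih =>
    rw [Finset.sum_insert hi, Finset.sum_insert hi]
    exact (add_inf_le_inf_add_inf (hx i) (Finset.sum_nonneg fun j _ => hx j) hc).trans
      (add_le_add_right ih _)

theorem partialSups_le_sum {x : ℕ → V} (hx : ∀ i, 0 ≤ x i) (m : ℕ) :
    partialSups x m ≤ ∑ k ∈ Finset.range (m + 1), x k :=
  partialSups_le _ _ _ fun _ hj =>
    Finset.single_le_sum (fun i _ => hx i) (Finset.mem_range.2 (Nat.lt_succ_of_le hj))

theorem sub_inf_le_sub {x v u : V} (hxu : x ≤ u) (hvu : v ≤ u) : x - x ⊓ v ≤ u - v := by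
  rw [sub_inf, sub_self]
  exact sup_le (sub_nonneg.2 hvu) (sub_le_sub_right hxu v)

/-- Disjoint positive elements below `d` have their sum below `d`. -/
theorem add_le_of_inf_eq_zero {a b d : V} (h : a ⊓ b = 0) (ha : a ≤ d) (hb : b ≤ d) :
    a + b ≤ d := by
  rw [← inf_add_sup a b, h, zero_add]
  exact sup_le ha hb

theorem mem_of_isSolid_of_nonneg {U : Set V} (hU : LatticeOrderedAddCommGroup.IsSolid U) {x y : V}
    (hy : y ∈ U) (hx : 0 ≤ x) (hxy : x ≤ y) : x ∈ U :=
  hU hy (by rwa [abs_of_nonneg hx, abs_of_nonneg (hx.trans hxy)])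

variable (V) in
/-- The Archimedean property of an ordered group, for positive elements. -/
def IsArchimedeanLattice : Prop :=
  ∀ w u : V, 0 ≤ w → (∀ n : ℕ, n • w ≤ u) → w = 0

/-- In an Archimedean vector lattice, the differences between the upper bounds of a bounded above
non-empty set and its elements have infimum `0`. -/
theorem isGLB_sub_of_bddAbove (hV : IsArchimedeanLattice V) {A : Set V} (hA : A.Nonempty)
    (hb : BddAbove A) : IsGLB {x | ∃ d ∈ upperBounds A, ∃ a ∈ A, x = d - a} 0 := by
  obtain ⟨a₀, ha₀⟩ := hA
  obtain ⟨d₀, hd₀⟩ := hb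
  refine ⟨?_, fun w hw => ?_⟩
  · rintro _ ⟨d, hd, a, ha, rfl⟩
    exact sub_nonneg.2 (hd ha)
  · have hw' : ∀ d ∈ upperBounds A, ∀ a ∈ A, w⁺ ≤ d - a := fun d hd a ha =>
      sup_le (hw ⟨d, hd, a, ha, rfl⟩) (sub_nonneg.2 (hd ha))
    have key : ∀ n : ℕ, d₀ - n • w⁺ ∈ upperBounds A := by
      intro n
      induction n with
      | zero => simpa using hd₀
      | succ n ih =>
        intro a ha
        have := hw' _ ih a ha
        rw [succ_nsmul, ← sub_sub]
        rwa [le_sub_comm] at this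
    have h0 : w⁺ = 0 := hV w⁺ (d₀ - a₀) (posPart_nonneg w) fun n => by
      rw [le_sub_comm]
      exact key n ha₀
    exact posPart_eq_zero.1 h0

end Inequalities

/-! ### Lebesgue topologies and normal sequences -/

section Lebesgue

variable {V : Type u} [AddCommGroup V] [Lattice V]

/-- The o-Lebesgue property for monotone nets, phrased for sets: every downward directed set with
infimum `0` meets every neighbourhood of `0`. -/
def IsMonotoneLebesgue (τ : TopologicalSpace V) : Prop :=
  ∀ D : Set V, D.Nonempty → DirectedOn (· ≥ ·) D → IsGLB D 0 → ∀ U ∈ @nhds V τ 0, ∃ d ∈ D, d ∈ U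

/-- A normal sequence of solid `τ`-neighbourhoods of `0`. -/
structure IsNormalSequence (τ : TopologicalSpace V) (W : ℕ → Set V) : Prop where
  mem_nhds : ∀ n, W n ∈ @nhds V τ 0
  solid : ∀ n, LatticeOrderedAddCommGroup.IsSolid (W n)
  add_mem : ∀ n, ∀ x ∈ W (n + 1), ∀ y ∈ W (n + 1), x + y ∈ W n

/-- The positive elements of the disjoint complement of the set `N`, tested against the positive
elements of `N`. -/
def positiveDisjoint (N : Set V) : Set V :=
  {v | 0 ≤ v ∧ ∀ b ∈ N, 0 ≤ b → b ⊓ v = 0}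

theorem orderConverges_of_isGLB {A : Type w} [Preorder A] {x : A → V} {D : Set V}
    (hne : D.Nonempty) (hdir : DirectedOn (· ≥ ·) D) (hD : IsGLB D 0)
    (h : ∀ d ∈ D, ∃ a₀, ∀ a, a₀ ≤ a → |x a| ≤ d) : OrderConverges x 0 := by
  refine ⟨Dᵒᵈ, inferInstance, ⟨fun a b => ?_⟩, ?_, fun b => (OrderDual.ofDual b : D),
    fun a b hab => hab, ?_, fun b => ?_⟩
  · obtain ⟨c, hc, h1, h2⟩ := hdir _ a.2 _ b.2
    exact ⟨⟨c, hc⟩, h1, h2⟩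
  · exact hne.to_subtype
  · convert hD
    exact Subtype.range_coe
  · obtain ⟨a₀, ha₀⟩ := h _ (OrderDual.ofDual b).2
    exact ⟨a₀, fun a ha => by rw [zero_sub, abs_neg]; exact ha₀ a ha⟩

theorem IsLocallySolidLinear.exists_solid_half [Module ℝ V] {τ : TopologicalSpace V}
    (h : IsLocallySolidLinear τ) {U : Set V}
    (hU : U ∈ @nhds V τ 0) : ∃ W ∈ @nhds V τ 0, LatticeOrderedAddCommGroup.IsSolid W ∧
      ∀ x ∈ W, ∀ y ∈ W, x + y ∈ U := by
  let _ := τ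
  have := h.add
  obtain ⟨W₁, hW₁, hadd⟩ := exists_nhds_zero_half hU
  obtain ⟨W, hW, hsol, hsub⟩ := h.solid W₁ hW₁
  exact ⟨W, hW, hsol, fun x hx y hy => hadd x (hsub hx) y (hsub hy)⟩

theorem directedOn_eventual_upperBounds {V : Type u} [Lattice V] (y : ℕ → V) :
    DirectedOn (· ≥ ·) {d | ∃ n, ∀ k, n ≤ k → y k ≤ d} := by
  rintro d ⟨n, hn⟩ d' ⟨n', hn'⟩
  exact ⟨d ⊓ d', ⟨max n n', fun k hk => le_inf (hn k (le_of_max_le_left hk))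
    (hn' k (le_of_max_le_right hk))⟩, inf_le_left, inf_le_right⟩

variable {τ σ : TopologicalSpace V} {W : ℕ → Set V}

theorem positiveDisjoint_of_le {N : Set V} {x y : V} (hy : y ∈ positiveDisjoint N) (hx : 0 ≤ x)
    (hxy : x ≤ y) : x ∈ positiveDisjoint N :=
  ⟨hx, fun b hb hb0 => le_antisymm ((inf_le_inf_left b hxy).trans (hy.2 b hb hb0).le)
    (le_inf hb0 hx)⟩

namespace IsNormalSequence

theorem zero_mem (hW : IsNormalSequence τ W) (n : ℕ) : (0 : V) ∈ W n :=
  @mem_of_mem_nhds V τ _ _ (hW.mem_nhds n)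

theorem inter {W' : ℕ → Set V} (hW : IsNormalSequence τ W) (hW' : IsNormalSequence τ W') :
    IsNormalSequence τ fun n => W n ∩ W' n where
  mem_nhds n := inter_mem (hW.mem_nhds n) (hW'.mem_nhds n)
  solid n _ hx _ hy := ⟨hW.solid n hx.1 hy, hW'.solid n hx.2 hy⟩
  add_mem n x hx y hy := ⟨hW.add_mem n x hx.1 y hy.1, hW'.add_mem n x hx.2 y hy.2⟩

theorem add_mem_iInter (hW : IsNormalSequence τ W) {x y : V} (hx : x ∈ ⋂ n, W n)
    (hy : y ∈ ⋂ n, W n) : x + y ∈ ⋂ n, W n :=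
  Set.mem_iInter.2 fun n =>
    hW.add_mem n x (Set.mem_iInter.1 hx _) y (Set.mem_iInter.1 hy _)

theorem antitone (hW : IsNormalSequence τ W) : Antitone W :=
  antitone_nat_of_succ_le fun n x hx => by simpa using hW.add_mem n x hx 0 (hW.zero_mem _)

theorem sum_mem (hW : IsNormalSequence τ W) (m : ℕ) : ∀ (n : ℕ) (x : ℕ → V),
    (∀ k, x k ∈ W (n + 1 + k)) → ∑ k ∈ Finset.range m, x k ∈ W n := by
  induction m with
  | zero => exact fun n x _ => by simpa using hW.zero_mem n
  | succ m ih =>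
    intro n x hx
    rw [Finset.sum_range_succ']
    refine hW.add_mem n _ (ih (n + 1) (fun k => x (k + 1)) fun k => ?_) _ (hx 0)
    have := hx (k + 1)
    rwa [show n + 1 + (k + 1) = n + 1 + 1 + k by omega] at this

end IsNormalSequence

theorem IsLocallySolidLinear.exists_isNormalSequence [Module ℝ V] (h : IsLocallySolidLinear τ)
    {U : Set V} (hU : U ∈ @nhds V τ 0) : ∃ W, IsNormalSequence τ W ∧ W 0 ⊆ U := by
  have step : ∀ X : {X : Set V // X ∈ @nhds V τ 0 ∧ LatticeOrderedAddCommGroup.IsSolid X},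
      ∃ Y : {X : Set V // X ∈ @nhds V τ 0 ∧ LatticeOrderedAddCommGroup.IsSolid X},
        ∀ x ∈ Y.1, ∀ y ∈ Y.1, x + y ∈ X.1 := fun X => by
    obtain ⟨Y, h1, h2, h3⟩ := h.exists_solid_half X.2.1
    exact ⟨⟨Y, h1, h2⟩, h3⟩
  choose f hf using step
  obtain ⟨X, hX, hsol, hsub⟩ := h.solid U hU
  let W : ℕ → {X : Set V // X ∈ @nhds V τ 0 ∧ LatticeOrderedAddCommGroup.IsSolid X} :=
    fun n => Nat.rec ⟨X, hX, hsol⟩ (fun _ Y => f Y) n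
  exact ⟨fun n => (W n).1, ⟨fun n => (W n).2.1, fun n => (W n).2.2, fun n => hf (W n)⟩, hsub⟩

variable [IsOrderedAddMonoid V]

theorem OrderConverges.unbounded {A : Type w} [Preorder A] {x : A → V} (h : OrderConverges x 0) :
    UnboundedOrderConverges x 0 := by
  obtain ⟨B, i1, i2, i3, y, hy, hglb, hxy⟩ := h
  refine fun z hz => ⟨B, i1, i2, i3, y, hy, hglb, fun b => ?_⟩
  obtain ⟨a₀, ha₀⟩ := hxy b
  refine ⟨a₀, fun a ha => ?_⟩
  beta_reduce
  rw [zero_sub, abs_neg, sub_zero, abs_of_nonneg (le_inf (abs_nonneg _) hz)]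
  refine inf_le_left.trans ?_
  simpa only [zero_sub, abs_neg] using ha₀ a ha

namespace IsNormalSequence

theorem mem_of_le (hW : IsNormalSequence τ W) {n : ℕ} {x y : V} (hy : y ∈ W n) (hx : 0 ≤ x)
    (hxy : x ≤ y) : x ∈ W n :=
  mem_of_isSolid_of_nonneg (hW.solid n) hy hx hxy

theorem mem_iInter_of_le (hW : IsNormalSequence τ W) {x y : V} (hy : y ∈ ⋂ n, W n) (hx : 0 ≤ x)
    (hxy : x ≤ y) : x ∈ ⋂ n, W n :=
  Set.mem_iInter.2 fun n => hW.mem_of_le (Set.mem_iInter.1 hy n) hx hxy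

end IsNormalSequence

theorem positiveDisjoint_add {N : Set V} {x y : V} (hx : x ∈ positiveDisjoint N)
    (hy : y ∈ positiveDisjoint N) : x + y ∈ positiveDisjoint N := by
  have h0 := add_nonneg hx.1 hy.1
  refine ⟨h0, fun b hb hb0 => le_antisymm ?_ (le_inf hb0 h0)⟩
  have := inf_add_le_inf_add_inf hx.1 hy.1 hb0
  rwa [hx.2 b hb hb0, hy.2 b hb hb0, add_zero] at this

/-- If the positive elements of an ideal, given as a set `Q`, are order dense below `u`, then they
approximate `u` from below in a Lebesgue topology. -/
theorem IsMonotoneLebesgue.exists_approx_of_orderDense (hV : IsArchimedeanLattice V)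
    (hL : IsMonotoneLebesgue τ) {Q : Set V} (h0 : (0 : V) ∈ Q) (hnn : ∀ q ∈ Q, 0 ≤ q)
    (hadd : ∀ q ∈ Q, ∀ r ∈ Q, q + r ∈ Q) (hdown : ∀ q ∈ Q, ∀ r, 0 ≤ r → r ≤ q → r ∈ Q) {u : V}
    (hu : 0 ≤ u) (hdense : ∀ p, 0 < p → p ≤ u → ∃ q ∈ Q, 0 < q ∧ q ≤ p) {U : Set V}
    (hU : U ∈ @nhds V τ 0) : ∃ q ∈ Q, q ≤ u ∧ u - q ∈ U := by
  obtain ⟨_, ⟨q, hq, hqu, rfl⟩, hmem⟩ := hL {x | ∃ q ∈ Q, q ≤ u ∧ x = u - q}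
    ⟨_, 0, h0, hu, rfl⟩
    (by
      rintro _ ⟨q, hq, hqu, rfl⟩ _ ⟨r, hr, hru, rfl⟩
      refine ⟨_, ⟨q ⊔ r, hdown _ (hadd q hq r hr) _ ((hnn q hq).trans le_sup_left) ?_,
        sup_le hqu hru, rfl⟩, sub_le_sub_left le_sup_left _, sub_le_sub_left le_sup_right _⟩
      exact sup_le (le_add_of_nonneg_right (hnn r hr)) (le_add_of_nonneg_left (hnn q hq)))
    (by
      refine ⟨?_, fun w hw => ?_⟩
      · rintro _ ⟨q, hq, hqu, rfl⟩
        exact sub_nonneg.2 hqu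
      · have hw' : ∀ q ∈ Q, q ≤ u → w⁺ ≤ u - q := fun q hq hqu =>
          sup_le (hw ⟨q, hq, hqu, rfl⟩) (sub_nonneg.2 hqu)
        by_contra hcon
        have hpos : 0 < w⁺ := lt_of_le_of_ne (posPart_nonneg w)
          fun h => hcon (posPart_eq_zero.1 h.symm)
        -- all multiples of an element `p` of `Q` below `w⁺` would stay below `u`
        obtain ⟨p, hp, hp0, hpw⟩ := hdense w⁺ hpos (by simpa using hw' 0 h0 hu)
        have key : ∀ n : ℕ, n • p ∈ Q ∧ n • p ≤ u := by
          intro n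
          induction n with
          | zero => simpa using ⟨h0, hu⟩
          | succ n ih =>
            rw [succ_nsmul]
            exact ⟨hadd _ ih.1 _ hp, le_sub_iff_add_le'.1 (hpw.trans (hw' _ ih.1 ih.2))⟩
        exact hp0.ne' (hV p u hp0.le fun n => (key n).2)) U hU
  exact ⟨q, hq, hqu, hmem⟩

/-- The kernel of a normal sequence is a band: an element outside it dominates a non-zero positive
element disjoint from it. -/
theorem IsNormalSequence.exists_pos_le_mem_positiveDisjoint (hV : IsArchimedeanLattice V)
    (hL : IsMonotoneLebesgue τ) (hW : IsNormalSequence τ W) {u : V} (hu : 0 ≤ u)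
    (huN : u ∉ ⋂ n, W n) : ∃ p ∈ positiveDisjoint (⋂ n, W n), 0 < p ∧ p ≤ u := by
  by_contra! hcon
  refine huN (Set.mem_iInter.2 fun n => ?_)
  obtain ⟨q, hq, hqu, hmem⟩ := hL.exists_approx_of_orderDense hV
    (Q := {b | 0 ≤ b ∧ b ∈ ⋂ n, W n}) ⟨le_rfl, Set.mem_iInter.2 hW.zero_mem⟩ (fun q hq => hq.1)
    (fun q hq r hr => ⟨add_nonneg hq.1 hr.1, hW.add_mem_iInter hq.2 hr.2⟩)
    (fun q hq r hr hrq => ⟨hr, hW.mem_iInter_of_le hq.2 hr hrq⟩) hu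
    (fun p hp hpu => by
      by_contra! hno
      refine hcon p ⟨hp.le, fun b hb hb0 => ?_⟩ hp hpu
      by_contra hne
      have hbp : 0 ≤ b ⊓ p := le_inf hb0 hp.le
      exact hno (b ⊓ p) ⟨hbp, hW.mem_iInter_of_le hb hbp inf_le_left⟩
        (lt_of_le_of_ne hbp (Ne.symm hne)) inf_le_right)
    (hW.mem_nhds (n + 1))
  have := hW.add_mem n _ hmem _ (Set.mem_iInter.1 hq.2 _)
  rwa [sub_add_cancel] at this

variable [Module ℝ V]

theorem IsUOLebesgue.isOLebesgue (h : IsUOLebesgue τ) : IsOLebesgue τ :=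
  ⟨h.locallySolid, fun A _ _ _ x hx => h.tendsto A x hx.unbounded⟩

theorem IsOLebesgue.isMonotoneLebesgue (h : IsOLebesgue τ) : IsMonotoneLebesgue τ := by
  intro D hne hdir hD U hU
  have : IsDirectedOrder Dᵒᵈ := ⟨fun a b => by
    obtain ⟨c, hc, h1, h2⟩ := hdir _ a.2 _ b.2
    exact ⟨⟨c, hc⟩, h1, h2⟩⟩
  have : Nonempty Dᵒᵈ := hne.to_subtype
  have ht := h.tendsto Dᵒᵈ (fun b => ((OrderDual.ofDual b : D) : V)) <|
    orderConverges_of_isGLB hne hdir hD fun d hd => ⟨OrderDual.toDual ⟨d, hd⟩, fun a ha => by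
      rw [abs_of_nonneg (hD.1 (OrderDual.ofDual a).2)]
      exact ha⟩
  obtain ⟨a, ha⟩ := (ht.eventually hU).exists
  exact ⟨_, (OrderDual.ofDual a).2, ha⟩

/-- A vector lattice with a Hausdorff locally solid linear topology is Archimedean. -/
theorem IsLocallySolidLinear.isArchimedeanLattice [IsOrderedModule ℝ V]
    (h : IsLocallySolidLinear τ) (h2 : @T2Space V τ) : IsArchimedeanLattice V := by
  let _ := τ
  have := h.smul
  intro w u hw hwu
  by_contra hne
  have hU : {w}ᶜ ∈ 𝓝 (0 : V) := isOpen_compl_singleton.mem_nhds (Ne.symm hne)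
  obtain ⟨U', hU', hsol, hsub⟩ := h.solid _ hU
  have ht : Tendsto (fun n : ℕ => (1 / ((n : ℝ) + 1)) • u) atTop (𝓝 0) := by
    simpa using (tendsto_one_div_add_atTop_nhds_zero_nat (𝕜 := ℝ)).smul_const u
  obtain ⟨n, hn⟩ := (ht.eventually hU').exists
  refine hsub (mem_of_isSolid_of_nonneg hsol hn hw ?_) rfl
  have h1 := smul_le_smul_of_nonneg_left (hwu (n + 1)) (by positivity : 0 ≤ 1 / ((n : ℝ) + 1))
  rw [← Nat.cast_smul_eq_nsmul ℝ, smul_smul] at h1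
  have h3 : 1 / ((n : ℝ) + 1) * ((n + 1 : ℕ) : ℝ) = 1 := by push_cast; field_simp
  rwa [h3, one_smul] at h1

/-- A bounded above upward directed set and its upper bounds come arbitrarily close in a Lebesgue
topology; this replaces the existence of suprema. -/
theorem IsMonotoneLebesgue.exists_upperBound_sub_mem (hV : IsArchimedeanLattice V)
    (hτ : IsLocallySolidLinear τ) (hL : IsMonotoneLebesgue τ) {A : Set V} (hne : A.Nonempty)
    (hdir : DirectedOn (· ≤ ·) A) {z : V} (hz : z ∈ upperBounds A) {U : Set V}
    (hU : U ∈ @nhds V τ 0) : ∃ d ∈ upperBounds A, d ≤ z ∧ ∃ a ∈ A, d - a ∈ U := by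
  obtain ⟨U', hU', hsol, hsub⟩ := hτ.solid U hU
  obtain ⟨_, ⟨d, hd, a, ha, rfl⟩, hmem⟩ := hL {x | ∃ d ∈ upperBounds A, ∃ a ∈ A, x = d - a}
    (by obtain ⟨a, ha⟩ := hne; exact ⟨_, z, hz, a, ha, rfl⟩)
    (by
      rintro _ ⟨d, hd, a, ha, rfl⟩ _ ⟨d', hd', a', ha', rfl⟩
      obtain ⟨c, hc, hac, hac'⟩ := hdir a ha a' ha'
      exact ⟨_, ⟨d ⊓ d', fun x hx => le_inf (hd hx) (hd' hx), c, hc, rfl⟩,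
        sub_le_sub inf_le_left hac, sub_le_sub inf_le_right hac'⟩)
    (isGLB_sub_of_bddAbove hV hne ⟨z, hz⟩) U' hU'
  have hdz : d ⊓ z ∈ upperBounds A := fun x hx => le_inf (hd hx) (hz hx)
  exact ⟨d ⊓ z, hdz, inf_le_right, a, ha, hsub <| mem_of_isSolid_of_nonneg hsol hmem
    (sub_nonneg.2 (hdz ha)) (sub_le_sub_right inf_le_left a)⟩

/-- Splitting off, up to a small error, the part of `x` in the kernel of a normal sequence. -/
theorem IsNormalSequence.exists_le_mem_positiveDisjoint_notMem (hV : IsArchimedeanLattice V)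
    (hτ : IsLocallySolidLinear τ) (hL : IsMonotoneLebesgue τ) (hW : IsNormalSequence τ W) {x : V}
    (hx : 0 ≤ x) (hx0 : x ∉ W 0) : ∃ v ∈ positiveDisjoint (⋂ n, W n), v ≤ x ∧ v ∉ W 2 := by
  set N := ⋂ n, W n with hN
  have h0N : (0 : V) ∈ positiveDisjoint N := ⟨le_rfl, fun b _ hb => inf_eq_right.2 hb⟩
  let A := {v | v ∈ positiveDisjoint N ∧ v ≤ x}
  obtain ⟨d, hd, hdx, a, ha, hda⟩ := hL.exists_upperBound_sub_mem hV hτ (A := A) ⟨0, h0N, hx⟩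
    (by
      rintro a ⟨ha, hax⟩ b ⟨hb, hbx⟩
      refine ⟨a ⊔ b, ⟨?_, sup_le hax hbx⟩, le_sup_left, le_sup_right⟩
      exact positiveDisjoint_of_le (positiveDisjoint_add ha hb) (ha.1.trans le_sup_left)
        (sup_le (le_add_of_nonneg_right hb.1) (le_add_of_nonneg_left ha.1)))
    (z := x) (fun a ha => ha.2) (hW.mem_nhds 2)
  -- a non-zero positive element of the complement below `x - d` could be added to all of `A`
  have hxd : x - d ∈ N := by
    by_contra hcon
    obtain ⟨p, hp, hp0, hpx⟩ :=
      hW.exists_pos_le_mem_positiveDisjoint hV hL (sub_nonneg.2 hdx) hcon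
    have key : ∀ n : ℕ, n • p ∈ A := by
      intro n
      induction n with
      | zero => simpa using ⟨h0N, hx⟩
      | succ n ih =>
        rw [succ_nsmul]
        refine ⟨positiveDisjoint_add ih.1 hp, ?_⟩
        calc n • p + p ≤ d + (x - d) := add_le_add (hd ih) hpx
          _ = x := by abel
    exact hp0.ne' (hV p x hp0.le fun n => (key n).2)
  refine ⟨a, ha.1, ha.2, fun ha2 => hx0 ?_⟩
  have h1 := hW.add_mem 0 _ (Set.mem_iInter.1 hxd 1) _ (hW.add_mem 1 _ hda _ ha2)
  rwa [show x - d + (d - a + a) = x by abel] at h1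

/-- A bounded sequence disjoint from the kernel of a normal sequence, the suprema of whose tails are
eventually small, is order null. -/
theorem IsNormalSequence.isGLB_tail (hV : IsArchimedeanLattice V) (hτ : IsLocallySolidLinear τ)
    (hL : IsMonotoneLebesgue τ) (hW : IsNormalSequence τ W) {y : ℕ → V} {z : V}
    (hyz : ∀ k, y k ≤ z) (hy : ∀ k, y k ∈ positiveDisjoint (⋂ n, W n))
    (htail : ∀ j, ∃ n, ∀ m, partialSups (fun k => y (n + k)) m ∈ W j) :
    IsGLB {d | ∃ n, ∀ k, n ≤ k → y k ≤ d} 0 := by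
  refine ⟨?_, fun w hw => ?_⟩
  · rintro d ⟨n, hn⟩
    exact (hy n).1.trans (hn n le_rfl)
  have hw' : ∀ d, (∃ n, ∀ k, n ≤ k → y k ≤ d) → w⁺ ≤ d := by
    rintro d ⟨n, hn⟩
    exact sup_le (hw ⟨n, hn⟩) ((hy n).1.trans (hn n le_rfl))
  have hwN : w⁺ ∈ ⋂ n, W n := by
    refine Set.mem_iInter.2 fun j => ?_
    obtain ⟨n, hn⟩ := htail (j + 1)
    obtain ⟨d, hd, -, _, ⟨m, rfl⟩, hdm⟩ := hL.exists_upperBound_sub_mem hV hτ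
      (A := Set.range (partialSups fun k => y (n + k))) (Set.range_nonempty _)
      (directedOn_range.2 (partialSups fun k => y (n + k)).monotone.directed_le)
      (z := z) (by rintro _ ⟨m, rfl⟩; exact partialSups_le _ _ _ fun k _ => hyz _)
      (hW.mem_nhds (j + 1))
    have hdj := hW.add_mem j _ hdm _ (hn m)
    rw [sub_add_cancel] at hdj
    refine hW.mem_of_le hdj (posPart_nonneg w) (hw' d ⟨n, fun k hk => ?_⟩)
    have := (le_partialSups (fun k => y (n + k)) (k - n)).trans (hd ⟨k - n, rfl⟩)
    simpa [Nat.add_sub_cancel' hk] using this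
  -- subtracting `w⁺` keeps an eventual upper bound, as `w⁺` is disjoint from the sequence
  have key : ∀ j : ℕ, ∃ n, ∀ k, n ≤ k → y k ≤ z - j • w⁺ := by
    intro j
    induction j with
    | zero => exact ⟨0, fun k _ => by simpa using hyz k⟩
    | succ j ih =>
      have hj := hw' _ ih
      obtain ⟨n, hn⟩ := ih
      refine ⟨n, fun k hk => ?_⟩
      have := add_le_of_inf_eq_zero ((hy k).2 _ hwN (posPart_nonneg w)) hj (hn k hk)
      rw [succ_nsmul, ← sub_sub]
      exact le_sub_iff_add_le'.2 this
  have h0 : w⁺ = 0 := hV w⁺ z (posPart_nonneg w) fun j => by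
    obtain ⟨n, hn⟩ := key j
    exact sub_nonneg.1 ((hy n).1.trans (hn n le_rfl))
  exact posPart_eq_zero.1 h0

/-! ### Uniqueness of the Hausdorff uo-Lebesgue topology -/

/-- On an order interval, a Hausdorff o-Lebesgue topology is finer than any locally solid
o-Lebesgue topology. -/
theorem IsMonotoneLebesgue.exists_nhds_inter_Icc_subset (hV : IsArchimedeanLattice V)
    (hτ : IsLocallySolidLinear τ) (hτL : IsMonotoneLebesgue τ) (hτ2 : @T2Space V τ)
    (hσ : IsLocallySolidLinear σ) (hσL : IsMonotoneLebesgue σ) {u : V} (hu : 0 ≤ u) {U : Set V}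
    (hU : U ∈ @nhds V σ 0) : ∃ X ∈ @nhds V τ 0, ∀ x ∈ X, 0 ≤ x → x ≤ u → x ∈ U := by
  obtain ⟨U', hU', hsol, hadd⟩ := hσ.exists_solid_half hU
  -- `u` is approximated by elements disjoint from the kernel of some normal sequence
  obtain ⟨v, ⟨hv0, W, hW, hvN⟩, hvu, huv⟩ := hσL.exists_approx_of_orderDense hV
    (Q := {v | 0 ≤ v ∧ ∃ W, IsNormalSequence τ W ∧ v ∈ positiveDisjoint (⋂ n, W n)})
    (by
      obtain ⟨W, hW, -⟩ := hτ.exists_isNormalSequence (@univ_mem V (@nhds V τ 0))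
      exact ⟨le_rfl, W, hW, le_rfl, fun b _ hb => inf_eq_right.2 hb⟩)
    (fun q hq => hq.1)
    (by
      rintro q ⟨hq0, W, hW, hq⟩ r ⟨hr0, W', hW', hr⟩
      refine ⟨add_nonneg hq0 hr0, _, hW.inter hW', positiveDisjoint_add
        ⟨hq0, fun b hb => hq.2 b ?_⟩ ⟨hr0, fun b hb => hr.2 b ?_⟩⟩
      · exact Set.mem_iInter.2 fun n => (Set.mem_iInter.1 hb n).1
      · exact Set.mem_iInter.2 fun n => (Set.mem_iInter.1 hb n).2)
    (by
      rintro q ⟨hq0, W, hW, hq⟩ r hr hrq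
      exact ⟨hr, W, hW, positiveDisjoint_of_le hq hr hrq⟩) hu
    (fun p hp hpu => by
      have hp' : {p}ᶜ ∈ @nhds V τ 0 := by
        let _ := τ
        exact isOpen_compl_singleton.mem_nhds hp.ne
      obtain ⟨W, hW, hWp⟩ := hτ.exists_isNormalSequence hp'
      obtain ⟨q, hq, hq0, hqp⟩ := hW.exists_pos_le_mem_positiveDisjoint hV hτL hp.le
        fun h => hWp (Set.mem_iInter.1 h 0) rfl
      exact ⟨q, ⟨hq0.le, W, hW, hq⟩, hq0, hqp⟩) hU'
  by_contra! hcon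
  choose x hxW hx0 hxu hxU using fun n => hcon (W n) (hW.mem_nhds n)
  have hy0 : ∀ n, 0 ≤ x n ⊓ v := fun n => le_inf (hx0 n) hv0
  have hyU : ∀ n, x n ⊓ v ∉ U' := fun n hn => hxU n <| by
    have h1 := mem_of_isSolid_of_nonneg hsol huv (sub_nonneg.2 inf_le_left)
      (sub_inf_le_sub (hxu n) hvu)
    have h2 := hadd _ h1 _ hn
    rwa [sub_add_cancel] at h2
  have hglb := hW.isGLB_tail hV hτ hτL (y := fun n => x n ⊓ v) (z := v) (fun k => inf_le_right)
    (fun k => positiveDisjoint_of_le hvN (hy0 k) inf_le_right) fun j => ⟨j + 1, fun m =>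
      hW.mem_of_le (hW.sum_mem (m + 1) j (fun k => x (j + 1 + k) ⊓ v) fun k =>
        hW.mem_of_le (hxW _) (hy0 _) inf_le_left)
        ((hy0 _).trans (le_partialSups_of_le (fun k => x (j + 1 + k) ⊓ v) (Nat.zero_le m)))
        (partialSups_le_sum (fun k => hy0 _) m)⟩
  obtain ⟨d, ⟨n, hn⟩, hd⟩ := hσL {d | ∃ n, ∀ k, n ≤ k → x k ⊓ v ≤ d}
    ⟨v, ⟨0, fun k _ => inf_le_right⟩⟩
    (directedOn_eventual_upperBounds fun n => x n ⊓ v) hglb U' hU'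
  exact hyU n (mem_of_isSolid_of_nonneg hsol hd (hy0 n) (hn n le_rfl))

/-- A uo-Lebesgue topology on an Archimedean vector lattice is unbounded: smallness of `x` follows
from smallness of `x ⊓ u` for a suitable `u`. -/
theorem IsUOLebesgue.exists_nhds_of_inf_mem (hV : IsArchimedeanLattice V) (hτ : IsUOLebesgue τ)
    {U : Set V} (hU : U ∈ @nhds V τ 0) :
    ∃ u, 0 ≤ u ∧ ∃ X ∈ @nhds V τ 0, ∀ x, 0 ≤ x → x ⊓ u ∈ X → x ∈ U := by
  have hL := hτ.isOLebesgue.isMonotoneLebesgue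
  obtain ⟨W, hW, hWU⟩ := hτ.locallySolid.exists_isNormalSequence hU
  by_contra! hcon
  have hstep : ∀ (u : V) (n : ℕ), ∃ v ∈ positiveDisjoint (⋂ n, W n), v ⊓ |u| ∈ W n ∧ v ∉ W 2 := by
    intro u n
    obtain ⟨x, hx0, hxu, hxU⟩ := hcon |u| (abs_nonneg u) (W n) (hW.mem_nhds n)
    obtain ⟨v, hv, hvx, hv2⟩ := hW.exists_le_mem_positiveDisjoint_notMem hV hτ.locallySolid hL hx0
      fun h => hxU (hWU h)
    exact ⟨v, hv, hW.mem_of_le hxu (le_inf hv.1 (abs_nonneg u)) (inf_le_inf_right _ hvx), hv2⟩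
  choose f hfN hfW hf2 using hstep
  -- each term is almost disjoint from the sum `s` of the previous ones
  let s : ℕ → V := fun n => Nat.rec 0 (fun k t => t + f t k) n
  have hs : ∀ n, s (n + 1) = s n + f (s n) n := fun n => rfl
  let x : ℕ → V := fun n => f (s n) n
  have hx0 : ∀ n, 0 ≤ x n := fun n => (hfN _ _).1
  have hsmono : Monotone s := monotone_nat_of_le_succ fun n => by
    rw [hs]; exact le_add_of_nonneg_right (hx0 n)
  have hs0 : ∀ n, 0 ≤ s n := fun n => hsmono (Nat.zero_le n)
  have hxs : ∀ {k n}, k < n → x k ≤ s n := fun {k n} h =>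
    (le_add_of_nonneg_left (hs0 k) : x k ≤ s (k + 1)).trans (hsmono h)
  have huo : UnboundedOrderConverges (fun a : ULift.{u} ℕ => x a.down) 0 := by
    intro z hz
    have hy0 : ∀ n, 0 ≤ x n ⊓ z := fun n => le_inf (hx0 n) hz
    have htail : ∀ j, ∃ n, ∀ m, partialSups (fun k => x (n + k) ⊓ z) m ∈ W j := by
      intro j
      let q := partialSups fun k => x k ⊓ z
      obtain ⟨d, hd, -, _, ⟨n, rfl⟩, hdn⟩ := hL.exists_upperBound_sub_mem hV hτ.locallySolid
        (A := Set.range q) (Set.range_nonempty _) (directedOn_range.2 q.monotone.directed_le)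
        (z := z) (by rintro _ ⟨m, rfl⟩; exact partialSups_le _ _ _ fun k _ => inf_le_right)
        (hW.mem_nhds (j + 1))
      let n' := max n (j + 1)
      refine ⟨n' + 1, fun m => ?_⟩
      set t := partialSups (fun k => x (n' + 1 + k) ⊓ z) m with ht
      have ht0 : 0 ≤ t := (hy0 _).trans
        (le_partialSups_of_le (fun k => x (n' + 1 + k) ⊓ z) (Nat.zero_le m))
      have hq0 : 0 ≤ q n' := (hy0 _).trans
        (le_partialSups_of_le (fun k => x k ⊓ z) (Nat.zero_le n'))
      have htd : t ≤ d := partialSups_le _ _ _ fun k _ =>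
        (le_partialSups (fun k => x k ⊓ z) (n' + 1 + k)).trans (hd ⟨_, rfl⟩)
      have hqs : q n' ≤ s (n' + 1) := partialSups_le _ _ _ fun k hk =>
        inf_le_left.trans (hxs (Nat.lt_succ_of_le hk))
      -- `t ⊔ q n'` is below `d`, hence exceeds `q n'` by little; `t ⊓ q n'` is small because the
      -- terms of the tail are almost disjoint from the earlier ones
      have h1 : t - t ⊓ q n' ∈ W (j + 1) :=
        hW.mem_of_le hdn (sub_nonneg.2 inf_le_left) <|
          (sub_inf_le_sub htd (hd ⟨n', rfl⟩)).trans
            (sub_le_sub_left (q.monotone (le_max_left n (j + 1))) d)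
      have h2 : t ⊓ q n' ∈ W (j + 1) := by
        have h3 : ∑ k ∈ Finset.range (m + 1), (x (n' + 1 + k) ⊓ z) ⊓ q n' ∈ W n' :=
          hW.sum_mem (m + 1) n' (fun k => (x (n' + 1 + k) ⊓ z) ⊓ q n') fun k => by
            refine hW.mem_of_le (hfW (s (n' + 1 + k)) (n' + 1 + k)) (le_inf (hy0 _) hq0) ?_
            refine le_inf (inf_le_left.trans inf_le_left) (inf_le_right.trans ?_)
            exact hqs.trans ((hsmono (Nat.le_add_right (n' + 1) k)).trans (le_abs_self _))
        refine hW.mem_of_le (hW.antitone (le_max_right n (j + 1)) h3) (le_inf ht0 hq0) ?_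
        exact (inf_le_inf_right _ (partialSups_le_sum (fun k => hy0 _) m)).trans
          (sum_inf_le_sum_inf _ (fun k => hy0 _) hq0)
      have h4 := hW.add_mem j _ h1 _ h2
      rwa [sub_add_cancel] at h4
    have hglb := hW.isGLB_tail hV hτ.locallySolid hL (y := fun n => x n ⊓ z) (z := z)
      (fun k => inf_le_right) (fun k => positiveDisjoint_of_le (hfN _ _) (hy0 k) inf_le_left) htail
    refine orderConverges_of_isGLB (D := {d | ∃ n, ∀ k, n ≤ k → x k ⊓ z ≤ d})
      ⟨z, ⟨0, fun k _ => inf_le_right⟩⟩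
      (directedOn_eventual_upperBounds fun n => x n ⊓ z) hglb ?_
    rintro d ⟨n, hn⟩
    refine ⟨⟨n⟩, fun a ha => ?_⟩
    rw [sub_zero, abs_of_nonneg (hx0 _), abs_of_nonneg (hy0 _)]
    exact hn _ ha
  have hev := (hτ.tendsto (ULift.{u} ℕ) _ huo).eventually (hW.mem_nhds 2)
  obtain ⟨a, ha⟩ := hev.exists
  exact hf2 _ _ ha

theorem IsHausdorffUOLebesgue.nhds_le [IsOrderedModule ℝ V] (hτ : IsHausdorffUOLebesgue τ)
    (hσ : IsHausdorffUOLebesgue σ) : @nhds V τ 0 ≤ @nhds V σ 0 := by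
  have hV := hτ.1.locallySolid.isArchimedeanLattice hτ.2
  intro U hU
  obtain ⟨U', hU', hsol, hsub⟩ := hσ.1.locallySolid.solid U hU
  obtain ⟨u, hu, X, hX, hXU⟩ := hσ.1.exists_nhds_of_inf_mem hV hU'
  obtain ⟨Y, hY, hYX⟩ := IsMonotoneLebesgue.exists_nhds_inter_Icc_subset hV hτ.1.locallySolid
    hτ.1.isOLebesgue.isMonotoneLebesgue hτ.2 hσ.1.locallySolid
    hσ.1.isOLebesgue.isMonotoneLebesgue hu hX
  obtain ⟨Y', hY', hYsol, hYsub⟩ := hτ.1.locallySolid.solid Y hY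
  refine mem_of_superset hY' fun x hx => hsub ?_
  have h0 : 0 ≤ |x| ⊓ u := le_inf (abs_nonneg x) hu
  have h1 : |x| ⊓ u ∈ Y' := hYsol hx (by rw [abs_of_nonneg h0]; exact inf_le_left)
  exact hsol (hXU _ (abs_nonneg x) (hYX _ (hYsub h1) h0 inf_le_right)) (abs_abs x).ge

/-- A vector lattice admits at most one Hausdorff uo-Lebesgue topology. -/
theorem IsHausdorffUOLebesgue.unique [IsOrderedModule ℝ V] (hτ : IsHausdorffUOLebesgue τ)
    (hσ : IsHausdorffUOLebesgue σ) : τ = σ :=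
  IsTopologicalAddGroup.ext hτ.1.locallySolid.add hσ.1.locallySolid.add
    (le_antisymm (hτ.nhds_le hσ) (hσ.nhds_le hτ))

end Lebesgue

/-! ### Gauge topologies and restrictions to sublattices -/

section Gauge

variable {V : Type u} [AddCommGroup V] [Lattice V] [Module ℝ V]

theorem IsLocallySolidLinear.tendsto_of_abs_le {A : Type*} {l : Filter A}
    {τ : TopologicalSpace V} (hτ : IsLocallySolidLinear τ) {f g : A → V}
    (hf : Tendsto f l (@nhds V τ 0)) (hgf : ∀ᶠ a in l, |g a| ≤ |f a|) :
    Tendsto g l (@nhds V τ 0) := by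
  intro U hU
  obtain ⟨U', hU', hsol, hsub⟩ := hτ.solid U hU
  refine mem_map.2 ?_
  filter_upwards [hf.eventually hU', hgf] with a ha hle
  exact hsub (hsol ha hle)

theorem IsLocallySolidLinear.tendsto_add_zero {A : Type*} {l : Filter A}
    {τ : TopologicalSpace V} (hτ : IsLocallySolidLinear τ) {f g : A → V}
    (hf : Tendsto f l (@nhds V τ 0)) (hg : Tendsto g l (@nhds V τ 0)) :
    Tendsto (fun a => f a + g a) l (@nhds V τ 0) := by
  let _ := τ
  have := hτ.add
  simpa using hf.add hg

theorem abs_smul_le_smul_abs [IsOrderedModule ℝ V] (c : ℝ) (x : V) : |c • x| ≤ |c| • |x| := by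
  rcases le_total 0 c with hc | hc
  · rw [abs_of_nonneg hc]
    refine sup_le (smul_le_smul_of_nonneg_left (le_abs_self x) hc) ?_
    rw [← smul_neg]
    exact smul_le_smul_of_nonneg_left (neg_le_abs x) hc
  · rw [abs_of_nonpos hc]
    refine sup_le ?_ ?_
    · rw [← neg_smul_neg]
      exact smul_le_smul_of_nonneg_left (neg_le_abs x) (neg_nonneg.2 hc)
    · rw [← neg_smul]
      exact smul_le_smul_of_nonneg_left (le_abs_self x) (neg_nonneg.2 hc)

theorem tendsto_abs_smul_zero {τ : TopologicalSpace V} (hτ : IsLocallySolidLinear τ) (x : V) :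
    Tendsto (fun c : ℝ => |c| • x) (𝓝 0) (@nhds V τ 0) := by
  let _ := τ
  have := hτ.smul
  have h : Continuous fun c : ℝ => |c| • x := continuous_abs.smul continuous_const
  simpa using h.tendsto 0

theorem subset_idealSpan (S : Set V) : S ⊆ idealSpan S := fun _ hx =>
  Submodule.mem_sInf.2 fun _ hJ => hJ.2 hx

theorem isSolid_idealSpan (S : Set V) :
    LatticeOrderedAddCommGroup.IsSolid (idealSpan S : Set V) := fun _ hx _ hy =>
  Submodule.mem_sInf.2 fun J hJ => hJ.1 (Submodule.mem_sInf.1 hx J hJ) hy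

variable [IsOrderedAddMonoid V]

theorem IsLocallySolidLinear.tendsto_of_le {A : Type*} {l : Filter A}
    {τ : TopologicalSpace V} (hτ : IsLocallySolidLinear τ) {f g : A → V}
    (hf : Tendsto f l (@nhds V τ 0)) (hg : ∀ a, 0 ≤ g a) (hgf : ∀ a, g a ≤ f a) :
    Tendsto g l (@nhds V τ 0) :=
  hτ.tendsto_of_abs_le hf <| Eventually.of_forall fun a => by
    rw [abs_of_nonneg (hg a), abs_of_nonneg ((hg a).trans (hgf a))]
    exact hgf a

theorem abs_smul_le_abs_nsmul_abs [IsOrderedModule ℝ V] {c : ℝ} {n : ℕ} (hc : |c| ≤ n) (x : V) :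
    |c • x| ≤ |n • (|x|)| := by
  rw [abs_of_nonneg (nsmul_nonneg (abs_nonneg x) n), ← Nat.cast_smul_eq_nsmul ℝ]
  exact (abs_smul_le_smul_abs c x).trans (smul_le_smul_of_nonneg_right hc (abs_nonneg x))

variable {ι : Type*} {W : Type*} [AddCommGroup W] [Lattice W] [IsOrderedAddMonoid W] [Module ℝ W]
  {p : ι → V → W} {τ : TopologicalSpace W}

/-- A family of monotone subadditive gauges with values in a locally solid space defines a locally
solid linear topology. -/
theorem isLocallySolidLinear_gaugeTopology [IsOrderedModule ℝ V] (hτ : IsLocallySolidLinear τ)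
    (h0 : ∀ i, p i 0 = 0) (hp : ∀ i b, 0 ≤ p i b) (hadd : ∀ i b c, p i (b + c) ≤ p i b + p i c)
    (hmono : ∀ i b c, |b| ≤ |c| → p i b ≤ p i c)
    (hsmul : ∀ i b, Tendsto (fun c : ℝ => p i (c • b)) (𝓝 0) (@nhds W τ 0)) :
    IsLocallySolidLinear (gaugeTopology p τ) := by
  let T := gaugeTopology p τ
  have hn : ∀ a, 𝓝 a = ⨅ i, comap (fun b => p i (b - a)) (@nhds W τ 0) :=
    nhds_gaugeTopology hτ h0 hp hadd
  have ht : ∀ {A : Type u} (l : Filter A) (x : A → V), Tendsto x l (𝓝 0) ↔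
      ∀ i, Tendsto (fun a => p i (x a)) l (@nhds W τ 0) := fun l x => by
    simp [hn, tendsto_iInf, tendsto_comap_iff, Function.comp_def]
  have hid : ∀ i, Tendsto (p i) (𝓝 0) (@nhds W τ 0) := (ht _ id).1 tendsto_id
  have hag : IsTopologicalAddGroup V := by
    refine IsTopologicalAddGroup.of_comm_of_nhds_zero ?_ ?_ fun x₀ => ?_
    · refine (ht _ _).2 fun i => hτ.tendsto_of_le (hτ.tendsto_add_zero
        ((hid i).comp tendsto_fst) ((hid i).comp tendsto_snd)) (fun a => hp i _)
        fun a => hadd i a.1 a.2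
    · refine (ht _ _).2 fun i => hτ.tendsto_of_le (hid i) (fun a => hp i _) fun a =>
        hmono i _ _ (abs_neg a).le
    · have hmap : ∀ l : Filter V, map (fun x => x₀ + x) l = comap (fun x => x - x₀) l := fun l => by
        simp_rw [add_comm x₀]
        exact Filter.map_equiv_symm (Equiv.subRight x₀) l
      rw [hmap, hn, hn, comap_iInf]
      simp [comap_comap, Function.comp_def]
  refine ⟨hag, ContinuousSMul.of_nhds_zero ?_ (fun b => ?_) fun c => ?_, fun U hU => ?_⟩
  · refine (ht _ _).2 fun i => hτ.tendsto_of_abs_le ((hid i).comp tendsto_snd) ?_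
    have h1 : ∀ᶠ c : ℝ in 𝓝 0, |c| ≤ 1 := by
      simpa using (continuous_abs.tendsto (0 : ℝ)).eventually_le_const (by simp : |(0 : ℝ)| < 1)
    filter_upwards [tendsto_fst.eventually h1] with a ha
    rw [abs_of_nonneg (hp i _), Function.comp_apply, abs_of_nonneg (hp i _)]
    refine hmono i _ _ ((abs_smul_le_abs_nsmul_abs (n := 1) (by simpa using ha) _).trans ?_)
    simp
  · rw [hn, tendsto_iInf]
    intro i
    simpa [tendsto_comap_iff, Function.comp_def] using hsmul i b
  · obtain ⟨n, hc⟩ := exists_nat_ge |c|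
    have key : ∀ (i : ι) (k : ℕ), Tendsto (fun b => p i (k • |b|)) (𝓝 0) (@nhds W τ 0) := by
      intro i k
      induction k with
      | zero => simpa [h0] using @tendsto_const_nhds W τ V 0 (𝓝 (0 : V))
      | succ k ih =>
        refine hτ.tendsto_of_le (hτ.tendsto_add_zero ih (hid i)) (fun b => hp i _) fun b => ?_
        rw [succ_nsmul]
        exact (hadd i _ _).trans (add_le_add_right (hmono i _ _ (abs_abs b).le) _)
    exact (ht _ _).2 fun i => hτ.tendsto_of_le (key i n) (fun b => hp i _) fun b =>
      hmono i _ _ (abs_smul_le_abs_nsmul_abs hc b)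
  · rw [hn] at hU
    refine iInf_sets_induct (p := fun s => ∃ X ∈ 𝓝 (0 : V),
      LatticeOrderedAddCommGroup.IsSolid X ∧ X ⊆ s) hU
      ⟨Set.univ, univ_mem, fun _ _ _ _ => trivial, subset_rfl⟩ ?_
    rintro i s₁ s₂ h₁ ⟨X, hX, hXsol, hXs⟩
    obtain ⟨U, hU, hUs⟩ := mem_comap.1 h₁
    obtain ⟨U', hU', hsol, hUU⟩ := hτ.solid U hU
    refine ⟨p i ⁻¹' U' ∩ X, inter_mem (hid i hU') hX, fun x hx y hy => ⟨?_, hXsol hx.2 hy⟩,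
      fun x hx => ⟨hUs ?_, hXs hx.2⟩⟩
    · exact mem_of_isSolid_of_nonneg hsol hx.1 (hp i y) (hmono i _ _ hy)
    · simpa using hUU hx.1

theorem isLocallySolidLinear_unboundedTopology [IsOrderedModule ℝ V] (S : Set V)
    {σ : TopologicalSpace V} (hσ : IsLocallySolidLinear σ) :
    IsLocallySolidLinear (unboundedTopology S σ) := by
  refine isLocallySolidLinear_gaugeTopology hσ (fun s => ?_)
    (fun s b => le_inf (abs_nonneg _) (abs_nonneg _)) (fun s b c => ?_)
    (fun s b c h => inf_le_inf_right _ h) fun s b => ?_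
  · rw [abs_zero]
    exact inf_of_le_left (abs_nonneg _)
  · exact (inf_le_inf_right _ (abs_add_le b c)).trans
      (add_inf_le_inf_add_inf (abs_nonneg b) (abs_nonneg c) (abs_nonneg _))
  · exact hσ.tendsto_of_le (tendsto_abs_smul_zero hσ |b|)
      (fun c => le_inf (abs_nonneg _) (abs_nonneg _))
      fun c => inf_le_left.trans (abs_smul_le_smul_abs c b)

/-- Induction over the ideal generated by a set; stability under scalars follows from solidity and
stability under sums. -/
theorem idealSpan_induction [IsOrderedModule ℝ V] {S : Set V} {P : V → Prop}
    (mem : ∀ x ∈ S, P x) (zero : P 0) (add : ∀ x y, P x → P y → P (x + y))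
    (solid : ∀ x y, |y| ≤ |x| → P x → P y) {x : V} (hx : x ∈ idealSpan S) : P x := by
  let J : Submodule ℝ V :=
    { carrier := {x | P x}
      zero_mem' := zero
      add_mem' := fun {x y} hx hy => add x y hx hy
      smul_mem' := fun c x hx => by
        obtain ⟨n, hc⟩ := exists_nat_ge |c|
        refine solid _ _ (abs_smul_le_abs_nsmul_abs hc x) ?_
        clear hc
        induction n with
        | zero => simpa using zero
        | succ n ih =>
          rw [succ_nsmul]
          exact add _ _ ih (solid _ _ (abs_abs x).le hx) }
  exact (Submodule.mem_sInf.1 hx) J ⟨fun x hx y hy => solid x y hy hx, mem⟩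

end Gauge

namespace VectorSublattice

variable {V : Type u} [AddCommGroup V] [Lattice V] [Module ℝ V]

instance [IsOrderedAddMonoid V] (G : VectorSublattice V) : IsOrderedAddMonoid G where
  add_le_add_left _ _ h c := add_le_add_left (α := V) h c

instance [IsOrderedAddMonoid V] [IsOrderedModule ℝ V] (G : VectorSublattice V) :
    IsOrderedModule ℝ G where
  smul_le_smul_of_nonneg_left _ hc _ _ h := smul_le_smul_of_nonneg_left (β := V) h hc
  smul_le_smul_of_nonneg_right x hx _ _ h :=
    smul_le_smul_of_nonneg_right (β := V) h (b := (x : V)) hx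

theorem coe_abs (G : VectorSublattice V) (x : G) : ((|x| : G) : V) = |(x : V)| := rfl

theorem coe_inf (G : VectorSublattice V) (x y : G) : ((x ⊓ y : G) : V) = (x : V) ⊓ y := rfl

/-- The restriction of a locally solid linear topology to a vector sublattice. -/
theorem isLocallySolidLinear_induced (G : VectorSublattice V) {τ : TopologicalSpace V}
    (hτ : IsLocallySolidLinear τ) : IsLocallySolidLinear (τ.induced (fun x : G => (x : V))) := by
  let _ := τ
  have := hτ.add
  have := hτ.smul
  let f : G →ₗ[ℝ] V :=
    { toFun := fun x => x, map_add' := fun _ _ => rfl, map_smul' := fun _ _ => rfl }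
  let _ : TopologicalSpace G := τ.induced f
  have h0 : 𝓝 (0 : G) = comap f (𝓝 0) := by rw [nhds_induced, map_zero]
  refine ⟨topologicalAddGroup_induced f, continuousSMul_induced f, fun U hU => ?_⟩
  replace hU : U ∈ 𝓝 (0 : G) := hU
  rw [h0] at hU
  obtain ⟨X, hX, hXU⟩ := hU
  obtain ⟨X', hX', hsol, hsub⟩ := hτ.solid X hX
  refine ⟨f ⁻¹' X', ?_, fun x hx y hy => hsol hx hy, fun x hx => hXU (hsub hx)⟩
  change f ⁻¹' X' ∈ 𝓝 (0 : G)
  rw [h0]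
  exact preimage_mem_comap hX'

theorem tendsto_induced (G : VectorSublattice V) (τ : TopologicalSpace V) {A : Type w}
    (l : Filter A) (x : A → G) :
    Tendsto x l (@nhds G (τ.induced (fun x : G => (x : V))) 0) ↔
      Tendsto (fun a => (x a : V)) l (@nhds V τ 0) := by
  rw [@nhds_induced, tendsto_comap_iff]
  rfl

end VectorSublattice

/-! ### Positive operators and pointwise infima -/

namespace OrderBoundedOperator

section Extension

variable {E : Type u} {F : Type v}
  [AddCommGroup E] [Lattice E] [IsOrderedAddMonoid E] [Module ℝ E] [IsOrderedModule ℝ E]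
  [AddCommGroup F] [Lattice F] [IsOrderedAddMonoid F] [Module ℝ F] [IsOrderedModule ℝ F]

/-- A positive additive and positively homogeneous map on the positive cone extends to a positive
operator. -/
theorem exists_extension {f : E → F} (h0 : ∀ x, 0 ≤ x → 0 ≤ f x)
    (hadd : ∀ x y, 0 ≤ x → 0 ≤ y → f (x + y) = f x + f y)
    (hsmul : ∀ (c : ℝ) x, 0 ≤ c → 0 ≤ x → f (c • x) = c • f x) :
    ∃ T : OrderBoundedOperator E F, ∀ x, 0 ≤ x → T x = f x := by
  have hsub : ∀ a b : E, 0 ≤ a → 0 ≤ b → f (a - b)⁺ - f (a - b)⁻ = f a - f b := by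
    intro a b ha hb
    rw [sub_eq_sub_iff_add_eq_add, ← hadd _ _ (posPart_nonneg _) hb,
      ← hadd _ _ ha (negPart_nonneg _)]
    congr 1
    rw [← sub_eq_sub_iff_add_eq_add, posPart_sub_negPart]
  let L : E →ₗ[ℝ] F :=
    { toFun := fun x => f x⁺ - f x⁻
      map_add' := fun x y => by
        have h : x + y = (x⁺ + y⁺) - (x⁻ + y⁻) := by
          rw [add_sub_add_comm, posPart_sub_negPart, posPart_sub_negPart]
        rw [h, hsub _ _ (add_nonneg (posPart_nonneg x) (posPart_nonneg y))
          (add_nonneg (negPart_nonneg x) (negPart_nonneg y)),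
          hadd _ _ (posPart_nonneg x) (posPart_nonneg y),
          hadd _ _ (negPart_nonneg x) (negPart_nonneg y), add_sub_add_comm]
      map_smul' := fun c x => by
        have h : c • x = c • x⁺ - c • x⁻ := by rw [← smul_sub, posPart_sub_negPart]
        rcases le_total 0 c with hc | hc
        · rw [h, hsub _ _ (smul_nonneg hc (posPart_nonneg x)) (smul_nonneg hc (negPart_nonneg x)),
            hsmul _ _ hc (posPart_nonneg x), hsmul _ _ hc (negPart_nonneg x), ← smul_sub]
          rfl
        · have hc' : 0 ≤ -c := neg_nonneg.2 hc
          have h' : c • x = (-c) • x⁻ - (-c) • x⁺ := by rw [h, neg_smul, neg_smul]; abel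
          rw [h', hsub _ _ (smul_nonneg hc' (negPart_nonneg x))
            (smul_nonneg hc' (posPart_nonneg x)), hsmul _ _ hc' (negPart_nonneg x),
            hsmul _ _ hc' (posPart_nonneg x), neg_smul, neg_smul, RingHom.id_apply, smul_sub]
          abel }
  have hL : ∀ x, 0 ≤ x → L x = f x := by
    intro x hx
    have hf0 : f 0 = 0 := by simpa using hsmul 0 0 le_rfl le_rfl
    change f x⁺ - f x⁻ = f x
    rw [posPart_eq_self.2 hx, negPart_eq_zero.2 hx, hf0, sub_zero]
  have hmono : Monotone L := fun x y h => by
    rw [← sub_nonneg, ← map_sub, hL _ (sub_nonneg.2 h)]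
    exact h0 _ (sub_nonneg.2 h)
  refine ⟨⟨L, fun a b => ⟨⟨L b, ?_⟩, ⟨L a, ?_⟩⟩⟩, hL⟩
  · rintro _ ⟨x, hx, rfl⟩
    exact hmono hx.2
  · rintro _ ⟨x, hx, rfl⟩
    exact hmono hx.1

theorem monotone_of_nonneg {T : OrderBoundedOperator E F} (hT : 0 ≤ T) : Monotone T := by
  intro x y h
  rw [← sub_nonneg, ← map_sub]
  exact hT _ (sub_nonneg.2 h)

theorem abs_apply_le_of_nonneg {T : OrderBoundedOperator E F} (hT : 0 ≤ T) (x : E) :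
    |T x| ≤ T |x| := by
  refine sup_le (monotone_of_nonneg hT (le_abs_self x)) ?_
  rw [← map_neg]
  exact monotone_of_nonneg hT (neg_le_abs x)

end Extension

variable {E : Type u} {F : Type v}
  [AddCommGroup E] [Lattice E] [IsOrderedAddMonoid E] [Module ℝ E] [IsOrderedModule ℝ E]
  [AddCommGroup F] [ConditionallyCompleteLattice F] [IsOrderedAddMonoid F] [Module ℝ F]
  [IsOrderedModule ℝ F]

/-- A downward directed set of positive operators has a pointwise infimum on the positive cone. -/
theorem exists_pointwise_isGLB {D : Set (OrderBoundedOperator E F)} (hne : D.Nonempty)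
    (hdir : DirectedOn (· ≥ ·) D) (h0 : ∀ d ∈ D, 0 ≤ d) :
    ∃ I : OrderBoundedOperator E F, ∀ x, 0 ≤ x → IsGLB ((fun d => d x) '' D) (I x) := by
  let f : E → F := fun x => sInf ((fun d : OrderBoundedOperator E F => d x) '' D)
  have hf : ∀ x, 0 ≤ x → IsGLB ((fun d : OrderBoundedOperator E F => d x) '' D) (f x) :=
    fun x hx => isGLB_csInf (hne.image _)
      ⟨0, by rintro _ ⟨d, hd, rfl⟩; exact h0 d hd x hx⟩
  have hle : ∀ x, 0 ≤ x → ∀ d ∈ D, f x ≤ d x := fun x hx d hd => (hf x hx).1 ⟨d, hd, rfl⟩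
  have hsmul_le : ∀ (c : ℝ) x, 0 < c → 0 ≤ x → f (c • x) ≤ c • f x := by
    intro c x hc hx
    have h1 : c⁻¹ • f (c • x) ≤ f x := (hf x hx).2 <| by
      rintro _ ⟨d, hd, rfl⟩
      have := smul_le_smul_of_nonneg_left (hle _ (smul_nonneg hc.le hx) d hd) (inv_nonneg.2 hc.le)
      rwa [map_smul, inv_smul_smul₀ hc.ne'] at this
    have := smul_le_smul_of_nonneg_left h1 hc.le
    rwa [smul_inv_smul₀ hc.ne'] at this
  obtain ⟨I, hI⟩ := exists_extension (f := f)
    (fun x hx => (hf x hx).2 <| by rintro _ ⟨d, hd, rfl⟩; exact h0 d hd x hx)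
    (fun x y hx hy => by
      apply le_antisymm
      · rw [← sub_le_iff_le_add]
        refine (hf x hx).2 ?_
        rintro _ ⟨d, hd, rfl⟩
        rw [sub_le_comm]
        refine (hf y hy).2 ?_
        rintro _ ⟨d', hd', rfl⟩
        obtain ⟨e, he, hed, hed'⟩ := hdir d hd d' hd'
        rw [sub_le_iff_le_add']
        refine (hle _ (add_nonneg hx hy) e he).trans ?_
        rw [map_add]
        exact add_le_add (hed x hx) (hed' y hy)
      · refine (hf _ (add_nonneg hx hy)).2 ?_
        rintro _ ⟨d, hd, rfl⟩
        change _ ≤ d (x + y)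
        rw [map_add]
        exact add_le_add (hle x hx d hd) (hle y hy d hd))
    (fun c x hc hx => by
      rcases hc.eq_or_lt with rfl | hc
      · simp [f, hne.image_const]
      · refine (hsmul_le c x hc hx).antisymm ?_
        have h := hsmul_le c⁻¹ (c • x) (inv_pos.2 hc) (smul_nonneg hc.le hx)
        rw [inv_smul_smul₀ hc.ne'] at h
        have := smul_le_smul_of_nonneg_left h hc.le
        rwa [smul_inv_smul₀ hc.ne'] at this)
  exact ⟨I, fun x hx => by rw [hI x hx]; exact hf x hx⟩

variable {τF : TopologicalSpace F}

/-- For an o-Lebesgue topology on the codomain, a downward directed set of positive operators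
approximates its pointwise infimum `I` at every `x ≥ 0`. -/
theorem exists_sub_apply_mem (hτF : IsOLebesgue τF) {D : Set (OrderBoundedOperator E F)}
    (hne : D.Nonempty) (hdir : DirectedOn (· ≥ ·) D) {I : OrderBoundedOperator E F} {x : E}
    (hx : 0 ≤ x) (hI : IsGLB ((fun d => d x) '' D) (I x)) {U : Set F} (hU : U ∈ @nhds F τF 0) :
    ∃ d ∈ D, d x - I x ∈ U := by
  obtain ⟨_, ⟨d, hd, rfl⟩, h⟩ := hτF.isMonotoneLebesgue
    ((fun d : OrderBoundedOperator E F => d x - I x) '' D) (hne.image _)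
    (by
      rintro _ ⟨d, hd, rfl⟩ _ ⟨d', hd', rfl⟩
      obtain ⟨e, he, hed, hed'⟩ := hdir d hd d' hd'
      exact ⟨_, ⟨e, he, rfl⟩, sub_le_sub_right (hed x hx) _, sub_le_sub_right (hed' x hx) _⟩)
    (by
      refine ⟨?_, fun w hw => ?_⟩
      · rintro _ ⟨d, hd, rfl⟩
        exact sub_nonneg.2 (hI.1 ⟨d, hd, rfl⟩)
      · have : w + I x ≤ I x := hI.2 <| by
          rintro _ ⟨d, hd, rfl⟩
          exact le_sub_iff_add_le.1 (hw ⟨d, hd, rfl⟩)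
        simpa using this) U hU
  exact ⟨d, hd, h⟩

/-- The dominating net is replaced by the set of its values, as its index type may live in a larger
universe than `F`, to which the o-Lebesgue property of `τF` does not apply. -/
theorem tendsto_abs_apply_of_orderConverges (hτF : IsOLebesgue τF) {A : Type w} [Preorder A]
    [IsDirectedOrder A] [Nonempty A] {T : A → OrderBoundedOperator E F} (hT : OrderConverges T 0)
    {x : E} (hx : 0 ≤ x) : Tendsto (fun a => |T a| x) atTop (@nhds F τF 0) := by
  obtain ⟨B, _, _, _, y, hy, hglb, hTy⟩ := hT
  have hdir : DirectedOn (· ≥ ·) (Set.range y) := by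
    rintro _ ⟨b, rfl⟩ _ ⟨b', rfl⟩
    obtain ⟨c, hc, hc'⟩ := exists_ge_ge b b'
    exact ⟨y c, ⟨c, rfl⟩, hy hc, hy hc'⟩
  obtain ⟨I, hI⟩ := exists_pointwise_isGLB (Set.range_nonempty y) hdir fun d hd => hglb.1 hd
  have hI0 : I ≤ 0 := hglb.2 fun d hd z hz => (hI z hz).1 ⟨d, hd, rfl⟩
  intro U hU
  obtain ⟨U', hU', hsol, hsub⟩ := hτF.locallySolid.solid U hU
  obtain ⟨_, ⟨b, rfl⟩, hb⟩ := exists_sub_apply_mem hτF (Set.range_nonempty y) hdir hx (hI x hx) hU'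
  obtain ⟨a₀, ha₀⟩ := hTy b
  refine mem_map.2 (mem_of_superset (Ici_mem_atTop a₀) fun a ha => hsub ?_)
  have h1 := ha₀ a ha
  rw [zero_sub, abs_neg] at h1
  have h2 : y b x ≤ y b x - I x := le_sub_self_iff _ |>.2 (hI0 x hx)
  exact mem_of_isSolid_of_nonneg hsol hb (abs_nonneg (T a) x hx) ((h1 x hx).trans h2)

theorem tendsto_apply_of_nonneg (hτF : IsLocallySolidLinear τF) {A : Type*} {l : Filter A}
    {T : A → OrderBoundedOperator E F} (hT : ∀ a, 0 ≤ T a) {x : E}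
    (h : Tendsto (fun a => T a |x|) l (@nhds F τF 0)) :
    Tendsto (fun a => T a x) l (@nhds F τF 0) :=
  hτF.tendsto_of_abs_le h <| Eventually.of_forall fun a =>
    (abs_apply_le_of_nonneg (hT a) x).trans (le_abs_self _)

/-- Convergence at the vectors of a set passes to the ideal that the set generates. -/
theorem tendsto_apply_idealSpan (hτF : IsLocallySolidLinear τF) {A : Type*} {l : Filter A}
    {T : A → OrderBoundedOperator E F} (hT : ∀ a, 0 ≤ T a) {S : Set E}
    (h : ∀ s ∈ S, Tendsto (fun a => T a |s|) l (@nhds F τF 0)) {x : E} (hx : x ∈ idealSpan S) :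
    Tendsto (fun a => T a x) l (@nhds F τF 0) := by
  have hpos : ∀ (x : E) a, 0 ≤ T a |x| := fun x a => hT a _ (abs_nonneg x)
  refine tendsto_apply_of_nonneg hτF hT (idealSpan_induction
    (P := fun x => Tendsto (fun a => T a |x|) l (@nhds F τF 0)) h ?_ ?_ ?_ hx)
  · simpa using @tendsto_const_nhds F τF A 0 l
  · intro x y hx hy
    refine hτF.tendsto_of_le (hτF.tendsto_add_zero hx hy) (hpos _) fun a => ?_
    rw [← map_add]
    exact monotone_of_nonneg (hT a) (abs_add_le x y)
  · exact fun x y hyx hx => hτF.tendsto_of_le hx (hpos y) fun a => monotone_of_nonneg (hT a) hyx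

end OrderBoundedOperator

/-! ### Test operators outside a sublattice -/

namespace VectorSublattice

section Remainder

variable {V : Type u} [AddCommGroup V] [Lattice V] [Module ℝ V]

/-- The remainders `r - r ⊓ g` of `r` with respect to the positive elements `g` of the vector
sublattice `G`. -/
def remainders (G : VectorSublattice V) (r : V) : Set V :=
  {d | ∃ g ∈ G, 0 ≤ g ∧ d = r - r ⊓ g}

variable [IsOrderedAddMonoid V] (G : VectorSublattice V) {r : V}

theorem remainders_nonempty : (G.remainders r).Nonempty :=
  ⟨_, 0, zero_mem G, le_rfl, rfl⟩

theorem directedOn_remainders : DirectedOn (· ≥ ·) (G.remainders r) := by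
  rintro _ ⟨g, hgG, hg, rfl⟩ _ ⟨g', hgG', hg', rfl⟩
  exact ⟨_, ⟨g ⊔ g', G.sup_mem' hgG hgG', hg.trans le_sup_left, rfl⟩,
    sub_le_sub_left (inf_le_inf_left _ le_sup_left) _,
    sub_le_sub_left (inf_le_inf_left _ le_sup_right) _⟩

theorem nonneg_of_mem_remainders : ∀ d ∈ G.remainders r, 0 ≤ d := by
  rintro _ ⟨g, -, -, rfl⟩
  exact sub_nonneg.2 inf_le_left

/-- The infimum of the remainders of `r` is disjoint from `G`. -/
theorem inf_eq_zero_of_isGLB_remainders {I : V} (hI : IsGLB (G.remainders r) I) {g : V}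
    (hgG : g ∈ G) (hg : 0 ≤ g) : g ⊓ I = 0 := by
  refine le_antisymm ?_ (le_inf hg (hI.2 G.nonneg_of_mem_remainders))
  have hadd : I + g ⊓ I ≤ I := hI.2 <| by
    rintro _ ⟨k, hkG, hk, rfl⟩
    have hk' : r ⊓ k + g ⊓ I ≤ r ⊓ (k + g) := by
      refine le_inf ?_ (add_le_add inf_le_right inf_le_left)
      rw [← le_sub_iff_add_le']
      exact inf_le_right.trans (hI.1 ⟨k, hkG, hk, rfl⟩)
    rw [← le_sub_iff_add_le]
    refine (hI.1 ⟨k + g, add_mem hkG hgG, add_nonneg hk hg, rfl⟩).trans ?_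
    rw [sub_sub]
    exact sub_le_sub_left hk' _
  simpa using hadd

end Remainder

end VectorSublattice

/-- The decomposition `r = I + r ⊓ g + (r - r ⊓ g - I)` tested against an element `t` disjoint from
`I`. -/
theorem inf_le_inf_add_remainder {V : Type u} [AddCommGroup V] [Lattice V] [IsOrderedAddMonoid V]
    {t r g I : V} (ht : 0 ≤ t) (hr : 0 ≤ r) (hg : 0 ≤ g) (hI : 0 ≤ I) (hIr : I ≤ r - r ⊓ g)
    (htI : t ⊓ I = 0) : t ⊓ r ≤ t ⊓ g + (r - r ⊓ g - I) := by
  have hrg : 0 ≤ r ⊓ g := le_inf hr hg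
  have he : 0 ≤ r - r ⊓ g - I := sub_nonneg.2 hIr
  calc t ⊓ r = t ⊓ (I + (r ⊓ g + (r - r ⊓ g - I))) := by congr 1; abel
    _ ≤ t ⊓ I + t ⊓ (r ⊓ g + (r - r ⊓ g - I)) :=
      inf_add_le_inf_add_inf hI (add_nonneg hrg he) ht
    _ ≤ t ⊓ I + (t ⊓ (r ⊓ g) + t ⊓ (r - r ⊓ g - I)) :=
      add_le_add_right (inf_add_le_inf_add_inf hrg he ht) _
    _ ≤ t ⊓ g + (r - r ⊓ g - I) := by
      rw [htI, zero_add]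
      exact add_le_add (inf_le_inf_left _ inf_le_right) inf_le_right

namespace OrderBoundedOperator

variable {E : Type u} {F : Type v}
  [AddCommGroup E] [Lattice E] [IsOrderedAddMonoid E] [Module ℝ E] [IsOrderedModule ℝ E]
  [AddCommGroup F] [ConditionallyCompleteLattice F] [IsOrderedAddMonoid F] [Module ℝ F]
  [IsOrderedModule ℝ F] {τF : TopologicalSpace F}

/-- If the net `T` takes its values in the vector sublattice `G`, then its convergence to `0` tested
by the operators in `G` implies that tested by all order bounded operators: an arbitrary test
operator is approximated by the sum of an element of the ideal generated by `G` and an operator `I`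
disjoint from `G`. -/
theorem tendsto_inf_apply_of_sublattice (hτF : IsOLebesgue τF)
    (G : VectorSublattice (OrderBoundedOperator E F)) {A : Type*} {l : Filter A} {T : A → G}
    (h : ∀ (R : G) (x : E), Tendsto (fun a => (|T a| ⊓ |R| : G).1 x) l (@nhds F τF 0))
    (R : OrderBoundedOperator E F) (x : E) :
    Tendsto (fun a => (|(T a : OrderBoundedOperator E F)| ⊓ |R|) x) l (@nhds F τF 0) := by
  have hTR : ∀ a, 0 ≤ |(T a : OrderBoundedOperator E F)| ⊓ |R| := fun a =>
    le_inf (abs_nonneg _) (abs_nonneg _)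
  refine tendsto_apply_of_nonneg hτF.locallySolid hTR ?_
  obtain ⟨I, hI⟩ := exists_pointwise_isGLB (G.remainders_nonempty (r := |R|))
    G.directedOn_remainders G.nonneg_of_mem_remainders
  have hIglb : IsGLB (G.remainders |R|) I :=
    ⟨fun d hd z hz => (hI z hz).1 ⟨d, hd, rfl⟩, fun J hJ z hz => (hI z hz).2 <| by
      rintro _ ⟨d, hd, rfl⟩
      exact hJ hd z hz⟩
  intro U hU
  obtain ⟨U', hU', hsol, hsub⟩ := hτF.locallySolid.solid U hU
  obtain ⟨X, hX, -, hadd⟩ := hτF.locallySolid.exists_solid_half hU'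
  obtain ⟨_, ⟨g, hgG, hg, rfl⟩, hgU⟩ := exists_sub_apply_mem hτF G.remainders_nonempty
    G.directedOn_remainders (abs_nonneg x) (hI _ (abs_nonneg x)) hX
  refine mem_map.2 ?_
  filter_upwards [(h ⟨g, hgG⟩ |x|).eventually hX] with a ha
  have hsum := hadd _ ha _ hgU
  have hle := inf_le_inf_add_remainder (abs_nonneg (T a : OrderBoundedOperator E F))
    (abs_nonneg R) hg (hIglb.2 G.nonneg_of_mem_remainders) (hIglb.1 ⟨g, hgG, hg, rfl⟩)
    (G.inf_eq_zero_of_isGLB_remainders hIglb (|T a|).2 (abs_nonneg (T a)))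
  refine hsub (mem_of_isSolid_of_nonneg hsol hsum (hTR a _ (abs_nonneg x)) ?_)
  have hcoe : ((|T a| ⊓ |⟨g, hgG⟩| : G) : OrderBoundedOperator E F) =
      |(T a : OrderBoundedOperator E F)| ⊓ g := by
    rw [VectorSublattice.coe_inf, VectorSublattice.coe_abs, VectorSublattice.coe_abs,
      abs_of_nonneg hg]
  have hval := hle _ (abs_nonneg x)
  rw [← hcoe] at hval
  exact hval

end OrderBoundedOperator

/-! ### The unbounded absolute strong operator topologies -/

theorem IsLocallySolidLinear.t2Space_iff {V : Type u} [AddCommGroup V] [Lattice V] [Module ℝ V]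
    {τ : TopologicalSpace V} (hτ : IsLocallySolidLinear τ) :
    @T2Space V τ ↔ ∀ x : V, Tendsto (fun _ : Unit => x) ⊤ (@nhds V τ 0) → x = 0 := by
  let _ := τ
  have := hτ.add
  refine ⟨fun _ x hx => tendsto_const_nhds_iff.1 hx, fun h => ?_⟩
  refine IsTopologicalAddGroup.t2Space_of_zero_sep fun x hx => ?_
  by_contra! hcon
  exact hx (h x fun U hU => mem_map.2 (univ_mem' fun _ => hcon U hU))

theorem eq_zero_of_abs_eq_zero {V : Type u} [AddCommGroup V] [Lattice V] [IsOrderedAddMonoid V]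
    {x : V} (h : |x| = 0) : x = 0 :=
  le_antisymm ((le_abs_self x).trans h.le) (neg_nonpos.1 ((neg_le_abs x).trans h.le))

section Operators

variable {E : Type u} {F : Type v}
  [AddCommGroup E] [Lattice E] [IsOrderedAddMonoid E] [Module ℝ E] [IsOrderedModule ℝ E]
  [AddCommGroup F] [ConditionallyCompleteLattice F] [IsOrderedAddMonoid F] [Module ℝ F]
  [IsOrderedModule ℝ F] {τF : TopologicalSpace F}

open OrderBoundedOperator

theorem isLocallySolidLinear_absoluteStrongTopology (S : Set E) (hτF : IsLocallySolidLinear τF) :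
    IsLocallySolidLinear (absoluteStrongTopology S τF) := by
  refine isLocallySolidLinear_gaugeTopology hτF (fun s => ?_)
    (fun s T => abs_nonneg T _ (abs_nonneg (s : E)))
    (fun s T R => abs_add_le T R _ (abs_nonneg (s : E)))
    (fun s T R h => h _ (abs_nonneg (s : E))) fun s T => ?_
  · simp
  · exact hτF.tendsto_of_le (tendsto_abs_smul_zero hτF (|T| |(s : E)|))
      (fun c => abs_nonneg (c • T) _ (abs_nonneg (s : E)))
      fun c => abs_smul_le_smul_abs c T _ (abs_nonneg (s : E))

theorem tendsto_unboundedTopology_univ_iff (hτF : IsLocallySolidLinear τF) {A : Type w}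
    (l : Filter A) (T : A → OrderBoundedOperator E F) :
    Tendsto T l (@nhds _ (unboundedTopology Set.univ (absoluteStrongTopology Set.univ τF)) 0) ↔
      ∀ (R : OrderBoundedOperator E F) (x : E),
        Tendsto (fun a => (|T a| ⊓ |R|) x) l (@nhds F τF 0) := by
  have habs : ∀ (R : OrderBoundedOperator E F) a, |(|T a| ⊓ |R|)| = |T a| ⊓ |R| := fun R a =>
    abs_of_nonneg (le_inf (abs_nonneg _) (abs_nonneg _))
  simp only [tendsto_unboundedTopology _ (isLocallySolidLinear_absoluteStrongTopology _ hτF),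
    tendsto_absoluteStrongTopology _ hτF, habs, Set.mem_univ, true_implies]
  exact ⟨fun h R x => tendsto_apply_of_nonneg hτF
    (fun a => le_inf (abs_nonneg _) (abs_nonneg _)) (h R x), fun h R x => h R |x|⟩

theorem isHausdorffUOLebesgue_unboundedTopology_univ (hτF : IsOLebesgue τF)
    (h2 : @T2Space F τF) : IsHausdorffUOLebesgue
      (unboundedTopology (Set.univ : Set (OrderBoundedOperator E F))
        (absoluteStrongTopology Set.univ τF)) := by
  have hls := isLocallySolidLinear_unboundedTopology (Set.univ : Set (OrderBoundedOperator E F))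
    (isLocallySolidLinear_absoluteStrongTopology Set.univ hτF.locallySolid)
  refine ⟨⟨hls, fun A _ _ _ T hT => ?_⟩, hls.t2Space_iff.2 fun T hT => ?_⟩
  · rw [tendsto_unboundedTopology_univ_iff hτF.locallySolid]
    intro R x
    have hnn : ∀ a, 0 ≤ |T a| ⊓ |R| := fun a => le_inf (abs_nonneg _) (abs_nonneg _)
    have h := hT |R| (abs_nonneg R)
    simp only [sub_zero] at h
    have ht := tendsto_abs_apply_of_orderConverges hτF h (abs_nonneg x)
    simp only [fun a => abs_of_nonneg (hnn a)] at ht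
    exact tendsto_apply_of_nonneg hτF.locallySolid hnn ht
  · rw [tendsto_unboundedTopology_univ_iff hτF.locallySolid] at hT
    refine eq_zero_of_abs_eq_zero (OrderBoundedOperator.ext fun x => ?_)
    have h := hT T x
    rw [inf_idem] at h
    exact hτF.locallySolid.t2Space_iff.1 h2 _ h

/-- If `T` vanishes on an ideal, then so does `|T|`, by the Riesz-Kantorovich formula. -/
theorem OrderBoundedOperator.abs_apply_eq_zero {J : Set E}
    (hJ : LatticeOrderedAddCommGroup.IsSolid J) {T : OrderBoundedOperator E F}
    (hT : ∀ x ∈ J, T x = 0) {x : E} (hx : x ∈ J) : |T| |x| = 0 := by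
  have hrk : ∀ R : OrderBoundedOperator E F, (∀ y ∈ J, R y = 0) → posOp R |x| = 0 := by
    intro R hR
    refine le_antisymm ?_ (posOp_nonneg R _ (abs_nonneg x))
    rw [posOp_apply R (abs_nonneg x)]
    refine rk_le R (abs_nonneg x) fun z hz hzx => (hR z ?_).le
    exact hJ hx (by rwa [abs_of_nonneg hz])
  have habs : |T| ≤ posOp T + posOp (-T) := sup_le
    ((le_posOp T).trans (le_add_of_nonneg_right (posOp_nonneg _)))
    ((le_posOp (-T)).trans (le_add_of_nonneg_left (posOp_nonneg _)))
  refine le_antisymm ((habs _ (abs_nonneg x)).trans ?_) (abs_nonneg T _ (abs_nonneg x))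
  rw [OrderBoundedOperator.add_apply, hrk T hT,
    hrk (-T) fun y hy => by rw [neg_apply, hT y hy, neg_zero], add_zero]

namespace VectorSublattice

variable (G : VectorSublattice (OrderBoundedOperator E F))

theorem isLocallySolidLinear_absoluteStrongTopology (S : Set E) (hτF : IsLocallySolidLinear τF) :
    IsLocallySolidLinear (G.absoluteStrongTopology S τF) :=
  G.isLocallySolidLinear_induced (_root_.isLocallySolidLinear_absoluteStrongTopology S hτF)

theorem inf_abs_nonneg (T R : G) : (0 : OrderBoundedOperator E F) ≤ (|T| ⊓ |R| : G).1 :=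
  (le_inf (abs_nonneg T) (abs_nonneg R) : (0 : G) ≤ |T| ⊓ |R|)

variable (𝓢 : Set G) (S : Set E)

theorem isLocallySolidLinear_unboundedTopology (hτF : IsLocallySolidLinear τF) :
    IsLocallySolidLinear (unboundedTopology 𝓢 (G.absoluteStrongTopology S τF)) :=
  _root_.isLocallySolidLinear_unboundedTopology 𝓢
    (G.isLocallySolidLinear_absoluteStrongTopology S hτF)

theorem tendsto_unboundedTopology_iff (hτF : IsLocallySolidLinear τF) {A : Type w} (l : Filter A)
    (T : A → G) :
    Tendsto T l (@nhds G (unboundedTopology 𝓢 (G.absoluteStrongTopology S τF)) 0) ↔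
      ∀ R ∈ 𝓢, ∀ s ∈ S, Tendsto (fun a => (|T a| ⊓ |R| : G).1 |s|) l (@nhds F τF 0) := by
  rw [tendsto_unboundedTopology _ (G.isLocallySolidLinear_absoluteStrongTopology S hτF)]
  refine forall₂_congr fun R _ => ?_
  rw [VectorSublattice.absoluteStrongTopology, tendsto_induced,
    tendsto_absoluteStrongTopology _ hτF]
  refine forall₂_congr fun s _ => ?_
  have habs : ∀ a, |((|T a| ⊓ |R| : G) : OrderBoundedOperator E F)| = (|T a| ⊓ |R| : G).1 :=
    fun a => abs_of_nonneg (G.inf_abs_nonneg (T a) R)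
  simp only [habs]

theorem tendsto_unboundedTopology_iff_idealSpan (hτF : IsLocallySolidLinear τF) {A : Type w}
    (l : Filter A) (T : A → G) :
    Tendsto T l (@nhds G (unboundedTopology 𝓢 (G.absoluteStrongTopology S τF)) 0) ↔
      ∀ R ∈ idealSpan 𝓢, ∀ x ∈ idealSpan S,
        Tendsto (fun a => (|T a| ⊓ |R| : G).1 x) l (@nhds F τF 0) := by
  rw [tendsto_unboundedTopology_iff G 𝓢 S hτF]
  constructor
  · intro h R hR x hx
    refine tendsto_apply_idealSpan hτF (fun a => G.inf_abs_nonneg (T a) R) (S := S) ?_ hx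
    refine idealSpan_induction (P := fun R => ∀ s ∈ S, Tendsto
      (fun a => (|T a| ⊓ |R| : G).1 |s|) l (@nhds F τF 0)) h ?_ ?_ ?_ hR
    · intro s hs
      have h0 : ∀ a, (|T a| ⊓ |0| : G) = 0 := fun a => by
        rw [abs_zero]
        exact inf_of_le_right (abs_nonneg _)
      simp only [h0]
      exact @tendsto_const_nhds F τF A 0 l
    · intro R R' hR hR' s hs
      refine hτF.tendsto_of_le (hτF.tendsto_add_zero (hR s hs) (hR' s hs))
        (fun a => G.inf_abs_nonneg _ _ _ (abs_nonneg s)) fun a => ?_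
      have hle : (|T a| ⊓ |R + R'| : G) ≤ |T a| ⊓ |R| + |T a| ⊓ |R'| :=
        (inf_le_inf_left _ (abs_add_le R R')).trans
          (inf_add_le_inf_add_inf (abs_nonneg R) (abs_nonneg R') (abs_nonneg (T a)))
      exact (show (|T a| ⊓ |R + R'| : G).1 ≤ (|T a| ⊓ |R| + |T a| ⊓ |R'| : G).1 from hle)
        _ (abs_nonneg s)
    · intro R R' hRR hR s hs
      refine hτF.tendsto_of_le (hR s hs)
        (fun a => G.inf_abs_nonneg _ _ _ (abs_nonneg s)) fun a => ?_
      have hle : (|T a| ⊓ |R'| : G) ≤ |T a| ⊓ |R| := inf_le_inf_left _ hRR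
      exact (show (|T a| ⊓ |R'| : G).1 ≤ (|T a| ⊓ |R| : G).1 from hle) _ (abs_nonneg s)
  · intro h R hR s hs
    exact h R (subset_idealSpan 𝓢 hR) _
      (isSolid_idealSpan S (subset_idealSpan S hs) (abs_abs s).le)

theorem isUOLebesgue_unboundedTopology (hτF : IsOLebesgue τF) (hG : G.IsRegular) :
    IsUOLebesgue (unboundedTopology 𝓢 (G.absoluteStrongTopology S τF)) := by
  refine ⟨G.isLocallySolidLinear_unboundedTopology 𝓢 S hτF.locallySolid, fun A _ _ _ T hT => ?_⟩
  rw [tendsto_unboundedTopology_iff G 𝓢 S hτF.locallySolid]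
  intro R _ s _
  have h := hT |R| (abs_nonneg R)
  simp only [sub_zero] at h
  have ht := tendsto_abs_apply_of_orderConverges hτF (hG A _ h) (abs_nonneg s)
  have habs : ∀ a, |((|T a| ⊓ |R| : G) : OrderBoundedOperator E F)| = (|T a| ⊓ |R| : G).1 :=
    fun a => abs_of_nonneg (G.inf_abs_nonneg (T a) R)
  simpa only [habs] using ht

/-- The Hausdorff criterion; it is decided by constant nets. -/
theorem t2Space_unboundedTopology_iff (hτF : IsLocallySolidLinear τF) (h2 : @T2Space F τF) :
    @T2Space G (unboundedTopology 𝓢 (G.absoluteStrongTopology S τF)) ↔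
      SeparatesOperators (idealSpan S : Set E) (G : Set (OrderBoundedOperator E F)) ∧
        IsOrderDense (idealSpan 𝓢) := by
  rw [(G.isLocallySolidLinear_unboundedTopology 𝓢 S hτF).t2Space_iff]
  have hconst : ∀ y : F, Tendsto (fun _ : Unit => y) ⊤ (@nhds F τF 0) ↔ y = 0 := fun y =>
    ⟨hτF.t2Space_iff.1 h2 y, by rintro rfl; exact @tendsto_const_nhds F τF Unit 0 ⊤⟩
  constructor
  · intro h
    refine ⟨fun T₁ h₁ T₂ h₂ hne => ?_, fun v hv => ?_⟩
    · by_contra! hcon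
      have hT : (⟨T₁, h₁⟩ - ⟨T₂, h₂⟩ : G) = 0 := by
        refine h _ ((tendsto_unboundedTopology_iff G 𝓢 S hτF _ _).2 fun R _ s hs => ?_)
        refine (hconst _).2 (le_antisymm ?_ (G.inf_abs_nonneg _ _ _ (abs_nonneg s)))
        have habs := abs_apply_eq_zero (T := T₁ - T₂) (isSolid_idealSpan S)
          (fun x hx => sub_eq_zero.2 (hcon x hx)) (subset_idealSpan S hs)
        rw [← habs]
        have hle : (|(⟨T₁, h₁⟩ - ⟨T₂, h₂⟩ : G)| ⊓ |R| : G) ≤ |(⟨T₁, h₁⟩ - ⟨T₂, h₂⟩ : G)| :=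
          inf_le_left
        exact (show (|(⟨T₁, h₁⟩ - ⟨T₂, h₂⟩ : G)| ⊓ |R| : G).1 ≤ |T₁ - T₂| from hle)
          _ (abs_nonneg s)
      exact hne (congrArg Subtype.val (sub_eq_zero.1 hT))
    · by_contra! hcon
      refine hv.ne' (h v ((tendsto_unboundedTopology_iff G 𝓢 S hτF _ _).2 fun R hR s _ => ?_))
      have h0 : 0 ≤ |v| ⊓ |R| := le_inf (abs_nonneg v) (abs_nonneg R)
      have hmem : |v| ⊓ |R| ∈ idealSpan 𝓢 :=
        isSolid_idealSpan 𝓢 (subset_idealSpan 𝓢 hR) (by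
          rw [abs_of_nonneg h0]
          exact inf_le_right)
      have hz : |v| ⊓ |R| = 0 := by
        by_contra hne
        refine hcon _ hmem (lt_of_le_of_ne h0 (Ne.symm hne)) ?_
        exact inf_le_left.trans (abs_of_nonneg hv.le).le
      exact (hconst _).2 (by rw [hz]; rfl)
  · rintro ⟨hsep, hdense⟩ T hT
    rw [tendsto_unboundedTopology_iff_idealSpan G 𝓢 S hτF] at hT
    by_contra hne
    have hpos : 0 < |T| := lt_of_le_of_ne (abs_nonneg T) fun h =>
      hne (eq_zero_of_abs_eq_zero h.symm)
    obtain ⟨g, hg, hg0, hgT⟩ := hdense |T| hpos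
    have hcoe : (g : OrderBoundedOperator E F) ≠ 0 := fun h => hg0.ne' (Subtype.ext h)
    obtain ⟨x, hx, hgx⟩ := hsep g g.2 0 (zero_mem G) hcoe
    refine hgx ?_
    have := (hconst _).1 (hT g hg x hx)
    rwa [abs_of_nonneg hg0.le, inf_eq_right.2 hgT] at this

theorem tendsto_unboundedTopology_univ_iff (hτF : IsLocallySolidLinear τF) {A : Type w}
    (l : Filter A) (T : A → G) :
    Tendsto T l (@nhds G (unboundedTopology Set.univ (G.absoluteStrongTopology Set.univ τF)) 0) ↔
      ∀ (R : G) (x : E), Tendsto (fun a => (|T a| ⊓ |R| : G).1 x) l (@nhds F τF 0) := by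
  rw [tendsto_unboundedTopology_iff G _ _ hτF]
  exact ⟨fun h R x => tendsto_apply_of_nonneg hτF (fun a => G.inf_abs_nonneg (T a) R)
    (h R trivial x trivial), fun h R _ x _ => h R |x|⟩

theorem forall_tendsto_inf_apply_iff (hτF : IsOLebesgue τF) {A : Type w} (l : Filter A)
    (T : A → G) :
    (∀ (R : G) (x : E), Tendsto (fun a => (|T a| ⊓ |R| : G).1 x) l (@nhds F τF 0)) ↔
      ∀ (R : OrderBoundedOperator E F) (x : E), Tendsto
        (fun a => (|(T a : OrderBoundedOperator E F)| ⊓ |R|) x) l (@nhds F τF 0) :=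
  ⟨fun h => tendsto_inf_apply_of_sublattice hτF G h, fun h R x => h R x⟩

theorem unboundedTopology_univ_eq_induced (hτF : IsOLebesgue τF) :
    unboundedTopology Set.univ (G.absoluteStrongTopology Set.univ τF) =
      (unboundedTopology (Set.univ : Set (OrderBoundedOperator E F))
        (_root_.absoluteStrongTopology Set.univ τF)).induced
          (fun T : G => (T : OrderBoundedOperator E F)) := by
  have h1 := G.isLocallySolidLinear_unboundedTopology Set.univ Set.univ hτF.locallySolid
  have h2 := G.isLocallySolidLinear_induced (_root_.isLocallySolidLinear_unboundedTopology
    (Set.univ : Set (OrderBoundedOperator E F))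
    (_root_.isLocallySolidLinear_absoluteStrongTopology Set.univ hτF.locallySolid))
  have key : ∀ (l : Filter G), Tendsto id l (@nhds G (unboundedTopology Set.univ
      (G.absoluteStrongTopology Set.univ τF)) 0) ↔ Tendsto id l (@nhds G
      ((unboundedTopology (Set.univ : Set (OrderBoundedOperator E F))
        (_root_.absoluteStrongTopology Set.univ τF)).induced
          (fun T : G => (T : OrderBoundedOperator E F))) 0) := fun l => by
    rw [G.tendsto_induced, G.tendsto_unboundedTopology_univ_iff hτF.locallySolid,
      _root_.tendsto_unboundedTopology_univ_iff hτF.locallySolid,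
      G.forall_tendsto_inf_apply_iff hτF]
  exact IsTopologicalAddGroup.ext h1.add h2.add
    (le_antisymm ((key _).1 tendsto_id) ((key _).2 tendsto_id))

theorem isHausdorffUOLebesgue_unboundedTopology_univ (hτF : IsOLebesgue τF)
    (h2 : @T2Space F τF) (hG : G.IsRegular) : IsHausdorffUOLebesgue
      (unboundedTopology Set.univ (G.absoluteStrongTopology Set.univ τF)) := by
  refine ⟨G.isUOLebesgue_unboundedTopology _ _ hτF hG,
    (G.t2Space_unboundedTopology_iff _ _ hτF.locallySolid h2).2 ⟨?_, ?_⟩⟩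
  · intro T₁ _ T₂ _ hne
    obtain ⟨x, hx⟩ := DFunLike.exists_ne hne
    exact ⟨x, subset_idealSpan _ trivial, hx⟩
  · exact fun v hv => ⟨v, subset_idealSpan _ trivial, hv, le_rfl⟩

end VectorSublattice

end Operators

theorem mainTheorem2
    {E : Type u} [AddCommGroup E] [Lattice E] [IsOrderedAddMonoid E] [Module ℝ E]
    [IsOrderedModule ℝ E]
    {F : Type v} [AddCommGroup F] [ConditionallyCompleteLattice F] [IsOrderedAddMonoid F]
    [Module ℝ F] [IsOrderedModule ℝ F]
    (τF : TopologicalSpace F) (hτF : IsOLebesgue τF)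
    (G : VectorSublattice (OrderBoundedOperator E F)) (hG : G.IsRegular) :
    -- the refined version, for test sets `𝓢 ⊆ G` and `S ⊆ E`
    (∀ (𝓢 : Set G) (S : Set E), 𝓢.Nonempty → S.Nonempty →
      IsUOLebesgue (unboundedTopology 𝓢 (G.absoluteStrongTopology S τF)) ∧
      (∀ (A : Type w) [Preorder A] [IsDirectedOrder A] [Nonempty A] (T : A → G),
        List.TFAE [
          Tendsto T atTop (@nhds G (unboundedTopology 𝓢 (G.absoluteStrongTopology S τF)) 0),
          ∀ R ∈ 𝓢, ∀ s ∈ S, Tendsto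
            (fun a => (|T a| ⊓ |R| : G).1 |s|) atTop (@nhds F τF 0),
          ∀ R ∈ idealSpan 𝓢, ∀ x ∈ idealSpan S, Tendsto
            (fun a => (|T a| ⊓ |R| : G).1 x) atTop (@nhds F τF 0)]) ∧
      (@T2Space F τF →
        (IsHausdorffUOLebesgue (unboundedTopology 𝓢 (G.absoluteStrongTopology S τF)) ↔
          SeparatesOperators (idealSpan S : Set E) (G : Set (OrderBoundedOperator E F)) ∧
            IsOrderDense (idealSpan 𝓢)) ∧
        (IsHausdorffUOLebesgue (unboundedTopology 𝓢 (G.absoluteStrongTopology S τF)) →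
          (∀ σ : TopologicalSpace G, IsHausdorffUOLebesgue σ →
            σ = unboundedTopology 𝓢 (G.absoluteStrongTopology S τF)) ∧
          unboundedTopology 𝓢 (G.absoluteStrongTopology S τF) =
            (unboundedTopology (Set.univ : Set (OrderBoundedOperator E F))
              (absoluteStrongTopology Set.univ τF)).induced
                (fun T : G => (T : OrderBoundedOperator E F)) ∧
          ∀ (A : Type w) [Preorder A] [IsDirectedOrder A] [Nonempty A] (T : A → G),
            Tendsto T atTop
                (@nhds G (unboundedTopology 𝓢 (G.absoluteStrongTopology S τF)) 0) ↔
              ∀ (R : OrderBoundedOperator E F) (x : E), Tendsto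
                (fun a => (|(T a : OrderBoundedOperator E F)| ⊓ |R|) x) atTop (@nhds F τF 0)))) ∧
    -- the corollary
    (@T2Space F τF →
      -- the Hausdorff uo-Lebesgue topology on the full lattice of order bounded operators
      (IsHausdorffUOLebesgue (unboundedTopology (Set.univ : Set (OrderBoundedOperator E F))
          (absoluteStrongTopology Set.univ τF)) ∧
        ∀ σ : TopologicalSpace (OrderBoundedOperator E F), IsHausdorffUOLebesgue σ →
          σ = unboundedTopology Set.univ (absoluteStrongTopology Set.univ τF)) ∧
      -- the Hausdorff uo-Lebesgue topology on `G`
      (∃! σ : TopologicalSpace G, IsHausdorffUOLebesgue σ) ∧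
      ∀ σ : TopologicalSpace G, IsHausdorffUOLebesgue σ →
        σ = unboundedTopology Set.univ (G.absoluteStrongTopology Set.univ τF) ∧
        σ = (unboundedTopology (Set.univ : Set (OrderBoundedOperator E F))
              (absoluteStrongTopology Set.univ τF)).induced
                (fun T : G => (T : OrderBoundedOperator E F)) ∧
        ∀ (A : Type w) [Preorder A] [IsDirectedOrder A] [Nonempty A] (T : A → G),
          List.TFAE [
            Tendsto T atTop (@nhds G σ 0),
            ∀ (R : G) (x : E), Tendsto
              (fun a => (|T a| ⊓ |R| : G).1 x) atTop (@nhds F τF 0),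
            ∀ (R : OrderBoundedOperator E F) (x : E), Tendsto
              (fun a => (|(T a : OrderBoundedOperator E F)| ⊓ |R|) x) atTop (@nhds F τF 0)]) := by
  refine ⟨fun 𝓢 S _ _ => ⟨G.isUOLebesgue_unboundedTopology 𝓢 S hτF hG, fun A _ _ _ T => ?_,
    fun h2 => ⟨?_, fun hH => ?_⟩⟩, fun h2 => ⟨⟨isHausdorffUOLebesgue_unboundedTopology_univ hτF h2,
      fun σ hσ => hσ.unique (isHausdorffUOLebesgue_unboundedTopology_univ hτF h2)⟩, ?_⟩⟩
  · tfae_have 1 ↔ 2 := G.tendsto_unboundedTopology_iff 𝓢 S hτF.locallySolid _ _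
    tfae_have 1 ↔ 3 := G.tendsto_unboundedTopology_iff_idealSpan 𝓢 S hτF.locallySolid _ _
    tfae_finish
  · rw [← G.t2Space_unboundedTopology_iff 𝓢 S hτF.locallySolid h2]
    exact ⟨fun h => h.2, fun h => ⟨G.isUOLebesgue_unboundedTopology 𝓢 S hτF hG, h⟩⟩
  · have huniv := hH.unique (G.isHausdorffUOLebesgue_unboundedTopology_univ hτF h2 hG)
    refine ⟨fun σ hσ => hσ.unique hH, huniv.trans (G.unboundedTopology_univ_eq_induced hτF),
      fun A _ _ _ T => ?_⟩
    rw [huniv, G.tendsto_unboundedTopology_univ_iff hτF.locallySolid,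
      G.forall_tendsto_inf_apply_iff hτF]
  · have hH := G.isHausdorffUOLebesgue_unboundedTopology_univ hτF h2 hG
    refine ⟨⟨_, hH, fun σ hσ => hσ.unique hH⟩, fun σ hσ => ?_⟩
    obtain rfl := hσ.unique hH
    refine ⟨rfl, G.unboundedTopology_univ_eq_induced hτF, fun A _ _ _ T => ?_⟩
    tfae_have 1 ↔ 2 := G.tendsto_unboundedTopology_univ_iff hτF.locallySolid _ _
    tfae_have 2 ↔ 3 := G.forall_tendsto_inf_apply_iff hτF _ _
    tfae_finish
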